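/- All graphs are finite, simple and undirected. A \emph{matching multicut on $\ell$ parts} of $G$ is a partition of $V(G)$ into $\ell$ nonempty sets $A_1,\dots,A_\ell$ such that every vertex of $A_i$ has at most one neighbour outside $A_i$. \textsc{Matching Multicut} asks, given $(G,\ell)$, whether $G$ has a matching multicut on at least $\ell$ parts. $\deg_S(v)$ is the number of neighbours of $v$ in $S$. Let $\ell\ge 1$, let $G$ have minimum degree at least $2$, and let $\varphi=\{A_1,\dots,A_\ell\}$ be pairwise disjoint nonempty subsets of $V(G)$; put $F=V(G)\setminus\bigcup_i A_i$. Indices $i,j,k$ are distinct except in B8. A rule is \emph{applicable} if its configuration is present. Stopping rules: (S1) some $v\in F$ has $\deg_{A_i}(v)\ge2$ and $\deg_{A_j}(v)\ge 2$; (S2) some $v\in F$ has neighbours in three parts $A_i,A_j,A_k$; (S3) some edge $uv$ with $u\in A_i$, $v\in A_j$ has $N(u)\cap N(v)\cap F\ne\emptyset$; (S4) some $v\in A_i$ has two neighbours outside $A_i\cup F$. Reduction rules: (R1) some $v\in A_i$ has two adjacent neighbours in $F$; (R2) some $v\in F$ has $\deg_{A_i}(v)\ge 2$ for a unique $i$;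 (R3) some edge $uv$ with $u\in A_i$, $v\in A_j$ has $(N(u)\cup N(v))\cap F\neq\emptyset$; (R4) distinct $u,v\in F$ have $N(u)=N(v)=\{x,y\}$, $x\in A_i$, $y\in A_j$; (R5) distinct $u,v\in F$ have $N(u)=N(v)=\{x,y\}$, $x\in A_i$, $y\in F$; (R6) some $v\in F$ has $N(v)=\{x,y\}$, $x\in A_i$, $y\in A_j$, $N(x)\subseteq A_i\cup\{v\}$, $N(y)\subseteq A_j\cup\{v\}$; (R7) there is a path $v'\,a\,v\,u\,w\,b\,w'$ with $a\in A_i$, $b\in A_j$, the other vertices in $F$, and $\deg(u)=\deg(v)=\deg(w)=2$. Branching configurations (not necessarily induced subgraphs on distinct vertices; all $v_p,v_p'\in F$): (B1) $a\in A_i$, edges $v_1a,av_2,v_1v_3,v_1v_4$; (B2) $a\in A_i$, $b\in A_j$, edges $v_1a,av_2,v_1b,v_1v_4$; (B3) $a\in A_i$, $b\in A_j$, edges $v_1a,v_1b,v_1v_2$; (B4) $a\in A_i$, $b\in A_j$, edges $v_1v_2,v_1v_3,v_1v_4,v_2a,av_2',v_3b,bv_3'$; (B4$'$) as B4 but with $a,b\in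 A_i$; (B5) $a,a'\in A_i$, $b\in A_j$, edges $v_1v_2,v_1v_3,v_1b,v_2a,av_2',v_3a',a'v_3'$; (B6) $a,a'\in A_i$, $b,b'\in A_j$, edges $v_1v_2,v_1v_3,v_1v_4,v_1v_5,v_2a,av_2',v_3a',a'v_3',v_4b,bv_4',v_5b',b'v_5'$; (B7) $a\in A_i$, $b\in A_j$, edges $v_1a,v_1b,av_2,bv_3$; (B8) $a\in A_i$, $b\in A_j$ with $i=j$ allowed, edges $v_1a,av_2,v_1v_3,v_3b$. Let $A_i'=\{v\in A_i:\deg_F(v)\ge2\}$, $F_i'=F\cap N(A_i')$, $F_i''=\{v\in F:\deg_{F_i'}(v)\ge2\}$, $F^*=F\setminus\bigcup_i(F_i'\cup F_i'')$, and $$\varphi^*=(A_1\cup F_1'\cup F_1'',\ \dots,\ A_{\ell-1}\cup F_{\ell-1}'\cup F_{\ell-1}'',\ A_\ell\cup F_\ell'\cup F_\ell''\cup F^*).$$ \textbf{Theorem.} (1) If no stopping, reduction or branching rule is applicable, then $\varphi^*$ is a matching multicut of $G$ on $\ell$ parts. (2) There are reals $0<\alpha_\ell\le\sqrt{\ell}$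 $(\ell\ge1)$, a constant $c$ and one algorithm that, for every $n$-vertex graph $G$ (with no condition on the minimum degree) and every $\ell\ge1$, decides whether $(G,\ell)$ is a yes-instance of \textsc{Matching Multicut} in time at most $c\,\alpha_\ell^{\,n}(n+1)^c$, that is, in time $O^*(\alpha_\ell^{\,n})$. Here $G$ is given by its adjacency matrix and $\ell$ in binary, and time is the number of steps of a pointer machine (a first-order recursive program on binary trees in which every elementary operation costs one step). -/

import Mathlib

namespace MatchingMulticut

section Graph

variable {V : Type*}

/-- A matching multicut of `G` on `ℓ` parts: a partition of the vertex set into nonempty sets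
`A 0, …, A (ℓ - 1)` such that each vertex of `A i` has at most one neighbour outside `A i`. -/
structure IsMatchingMulticut (G : SimpleGraph V) {ℓ : ℕ} (A : Fin ℓ → Set V) : Prop where
  nonempty : ∀ i, (A i).Nonempty
  disjoint : ∀ i j, i ≠ j → Disjoint (A i) (A j)
  cover : ∀ v, ∃ i, v ∈ A i
  matching : ∀ i, ∀ v ∈ A i, (G.neighborSet v \ A i).ncard ≤ 1

/-- The yes-instances of the problem Matching Multicut: `G` has a matching multicut on at least
`ℓ` parts. -/
def HasMatchingMulticut (G : SimpleGraph V) (ℓ : ℕ) : Prop :=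
  ∃ k, ℓ ≤ k ∧ ∃ A : Fin k → Set V, IsMatchingMulticut G A

/-- The number of neighbours of `v` in `S`. -/
noncomputable def degIn (G : SimpleGraph V) (S : Set V) (v : V) : ℕ :=
  (G.neighborSet v ∩ S).ncard

/-- The number of neighbours of `v`. -/
noncomputable def deg (G : SimpleGraph V) (v : V) : ℕ := (G.neighborSet v).ncard

variable {ℓ : ℕ}

/-- The free vertices: those not yet assigned to any part. -/
def free (A : Fin ℓ → Set V) : Set V := {v | ∀ i, v ∉ A i}

/-! The stopping rules. -/

def S1 (G : SimpleGraph V) (A : Fin ℓ → Set V) : Prop :=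
  ∃ v ∈ free A, ∃ i j, i ≠ j ∧ 2 ≤ degIn G (A i) v ∧ 2 ≤ degIn G (A j) v

def S2 (G : SimpleGraph V) (A : Fin ℓ → Set V) : Prop :=
  ∃ v ∈ free A, ∃ i j k, i ≠ j ∧ i ≠ k ∧ j ≠ k ∧
    1 ≤ degIn G (A i) v ∧ 1 ≤ degIn G (A j) v ∧ 1 ≤ degIn G (A k) v

def S3 (G : SimpleGraph V) (A : Fin ℓ → Set V) : Prop :=
  ∃ i j, i ≠ j ∧ ∃ u ∈ A i, ∃ v ∈ A j, G.Adj u v ∧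
    (G.neighborSet u ∩ G.neighborSet v ∩ free A).Nonempty

def S4 (G : SimpleGraph V) (A : Fin ℓ → Set V) : Prop :=
  ∃ i, ∃ v ∈ A i, 2 ≤ (G.neighborSet v \ (A i ∪ free A)).ncard

/-- Some stopping rule is applicable. -/
def StoppingApplicable (G : SimpleGraph V) (A : Fin ℓ → Set V) : Prop :=
  S1 G A ∨ S2 G A ∨ S3 G A ∨ S4 G A

/-! The reduction rules. Each predicate says that the rule is applicable, that is, that its
configuration is present and that the rule assigns at least one free vertex to a part. -/

/-- A vertex of `A i` has two adjacent free neighbours (they go to `A i`). -/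
def R1 (G : SimpleGraph V) (A : Fin ℓ → Set V) : Prop :=
  ∃ i, ∃ v ∈ A i, ∃ x ∈ free A, ∃ y ∈ free A, G.Adj v x ∧ G.Adj v y ∧ G.Adj x y

/-- A free vertex has two neighbours in exactly one part `A i` (it goes to `A i`). -/
def R2 (G : SimpleGraph V) (A : Fin ℓ → Set V) : Prop :=
  ∃ v ∈ free A, ∃! i, 2 ≤ degIn G (A i) v

/-- An edge `uv` joins `A i` to `A j` and one of its ends has a free neighbour (the free
neighbours of `u` go to `A i`, those of `v` to `A j`). -/
def R3 (G : SimpleGraph V) (A : Fin ℓ → Set V) : Prop :=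
  ∃ i j, i ≠ j ∧ ∃ u ∈ A i, ∃ v ∈ A j, G.Adj u v ∧
    ((G.neighborSet u ∩ free A).Nonempty ∨ (G.neighborSet v ∩ free A).Nonempty)

/-- Two free twins with `N(u) = N(v) = {x, y}`, `x ∈ A i`, `y ∈ A j`
(`u` goes to `A i`, `v` to `A j`). -/
def R4 (G : SimpleGraph V) (A : Fin ℓ → Set V) : Prop :=
  ∃ i j, i ≠ j ∧ ∃ u ∈ free A, ∃ v ∈ free A, u ≠ v ∧ ∃ x ∈ A i, ∃ y ∈ A j,
    G.neighborSet u = {x, y} ∧ G.neighborSet v = {x, y}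

/-- Two free twins with `N(u) = N(v) = {x, y}`, `x ∈ A i`, `y` free (`u` goes to `A i`). -/
def R5 (G : SimpleGraph V) (A : Fin ℓ → Set V) : Prop :=
  ∃ i, ∃ u ∈ free A, ∃ v ∈ free A, u ≠ v ∧ ∃ x ∈ A i, ∃ y ∈ free A,
    G.neighborSet u = {x, y} ∧ G.neighborSet v = {x, y}

/-- A free vertex with `N(v) = {x, y}`, `x ∈ A i`, `y ∈ A j`, where `v` is the only neighbour of
`x` outside `A i` and the only neighbour of `y` outside `A j` (`v` goes to `A i`). -/
def R6 (G : SimpleGraph V) (A : Fin ℓ → Set V) : Prop :=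
  ∃ i j, i ≠ j ∧ ∃ v ∈ free A, ∃ x ∈ A i, ∃ y ∈ A j,
    G.neighborSet v = {x, y} ∧ G.neighborSet x ⊆ A i ∪ {v} ∧ G.neighborSet y ⊆ A j ∪ {v}

/-- A path `v' a v u w b w'` with `a ∈ A i`, `b ∈ A j`, the other vertices free, and `u`, `v`, `w`
of degree two (`u` and `v` go to `A i`, `w` to `A j`). -/
def R7 (G : SimpleGraph V) (A : Fin ℓ → Set V) : Prop :=
  ∃ i j, i ≠ j ∧ ∃ u ∈ free A, ∃ v ∈ free A, ∃ w ∈ free A, ∃ v' ∈ free A, ∃ w' ∈ free A,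
    ∃ a ∈ A i, ∃ b ∈ A j, [u, v, w, v', w'].Nodup ∧
    deg G u = 2 ∧ deg G v = 2 ∧ deg G w = 2 ∧
    G.Adj u v ∧ G.Adj u w ∧ G.Adj v a ∧ G.Adj a v' ∧ G.Adj w b ∧ G.Adj b w'

/-- Some reduction rule is applicable. -/
def ReductionApplicable (G : SimpleGraph V) (A : Fin ℓ → Set V) : Prop :=
  R1 G A ∨ R2 G A ∨ R3 G A ∨ R4 G A ∨ R5 G A ∨ R6 G A ∨ R7 G A

/-! The branching rules. A rule is applicable when its configuration occurs as a (not necessarily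
induced) subgraph on distinct vertices; `v₁, v₂, …` and `v₂', v₃', …` are free, `a`, `a'`, `b`,
`b'` are assigned. The algorithm branches on the part that receives `v₁`. -/

def B1 (G : SimpleGraph V) (A : Fin ℓ → Set V) : Prop :=
  ∃ i, ∃ v₁ ∈ free A, ∃ v₂ ∈ free A, ∃ v₃ ∈ free A, ∃ v₄ ∈ free A, ∃ a ∈ A i,
    [v₁, v₂, v₃, v₄].Nodup ∧ G.Adj v₁ a ∧ G.Adj a v₂ ∧ G.Adj v₁ v₃ ∧ G.Adj v₁ v₄

def B2 (G : SimpleGraph V) (A : Fin ℓ → Set V) : Prop :=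
  ∃ i j, i ≠ j ∧ ∃ v₁ ∈ free A, ∃ v₂ ∈ free A, ∃ v₄ ∈ free A, ∃ a ∈ A i, ∃ b ∈ A j,
    [v₁, v₂, v₄].Nodup ∧ G.Adj v₁ a ∧ G.Adj a v₂ ∧ G.Adj v₁ b ∧ G.Adj v₁ v₄

def B3 (G : SimpleGraph V) (A : Fin ℓ → Set V) : Prop :=
  ∃ i j, i ≠ j ∧ ∃ v₁ ∈ free A, ∃ v₂ ∈ free A, ∃ a ∈ A i, ∃ b ∈ A j,
    G.Adj v₁ v₂ ∧ G.Adj v₁ a ∧ G.Adj v₁ b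

def B4 (G : SimpleGraph V) (A : Fin ℓ → Set V) : Prop :=
  ∃ i j, i ≠ j ∧ ∃ v₁ ∈ free A, ∃ v₂ ∈ free A, ∃ v₃ ∈ free A, ∃ v₄ ∈ free A,
    ∃ v₂' ∈ free A, ∃ v₃' ∈ free A, ∃ a ∈ A i, ∃ b ∈ A j,
    [v₁, v₂, v₃, v₄, v₂', v₃'].Nodup ∧
    G.Adj v₁ v₂ ∧ G.Adj v₁ v₃ ∧ G.Adj v₁ v₄ ∧
    G.Adj v₂ a ∧ G.Adj a v₂' ∧ G.Adj v₃ b ∧ G.Adj b v₃'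

def B4' (G : SimpleGraph V) (A : Fin ℓ → Set V) : Prop :=
  ∃ i, ∃ v₁ ∈ free A, ∃ v₂ ∈ free A, ∃ v₃ ∈ free A, ∃ v₄ ∈ free A,
    ∃ v₂' ∈ free A, ∃ v₃' ∈ free A, ∃ a ∈ A i, ∃ a' ∈ A i, a ≠ a' ∧
    [v₁, v₂, v₃, v₄, v₂', v₃'].Nodup ∧
    G.Adj v₁ v₂ ∧ G.Adj v₁ v₃ ∧ G.Adj v₁ v₄ ∧
    G.Adj v₂ a ∧ G.Adj a v₂' ∧ G.Adj v₃ a' ∧ G.Adj a' v₃'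

def B5 (G : SimpleGraph V) (A : Fin ℓ → Set V) : Prop :=
  ∃ i j, i ≠ j ∧ ∃ v₁ ∈ free A, ∃ v₂ ∈ free A, ∃ v₃ ∈ free A,
    ∃ v₂' ∈ free A, ∃ v₃' ∈ free A, ∃ a ∈ A i, ∃ a' ∈ A i, ∃ b ∈ A j, a ≠ a' ∧
    [v₁, v₂, v₃, v₂', v₃'].Nodup ∧
    G.Adj v₁ v₂ ∧ G.Adj v₁ v₃ ∧ G.Adj v₁ b ∧
    G.Adj v₂ a ∧ G.Adj a v₂' ∧ G.Adj v₃ a' ∧ G.Adj a' v₃'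

def B6 (G : SimpleGraph V) (A : Fin ℓ → Set V) : Prop :=
  ∃ i j, i ≠ j ∧ ∃ v₁ ∈ free A, ∃ v₂ ∈ free A, ∃ v₃ ∈ free A, ∃ v₄ ∈ free A, ∃ v₅ ∈ free A,
    ∃ v₂' ∈ free A, ∃ v₃' ∈ free A, ∃ v₄' ∈ free A, ∃ v₅' ∈ free A,
    ∃ a ∈ A i, ∃ a' ∈ A i, ∃ b ∈ A j, ∃ b' ∈ A j, a ≠ a' ∧ b ≠ b' ∧
    [v₁, v₂, v₃, v₄, v₅, v₂', v₃', v₄', v₅'].Nodup ∧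
    G.Adj v₁ v₂ ∧ G.Adj v₁ v₃ ∧ G.Adj v₁ v₄ ∧ G.Adj v₁ v₅ ∧
    G.Adj v₂ a ∧ G.Adj a v₂' ∧ G.Adj v₃ a' ∧ G.Adj a' v₃' ∧
    G.Adj v₄ b ∧ G.Adj b v₄' ∧ G.Adj v₅ b' ∧ G.Adj b' v₅'

def B7 (G : SimpleGraph V) (A : Fin ℓ → Set V) : Prop :=
  ∃ i j, i ≠ j ∧ ∃ v₁ ∈ free A, ∃ v₂ ∈ free A, ∃ v₃ ∈ free A, ∃ a ∈ A i, ∃ b ∈ A j,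
    [v₁, v₂, v₃].Nodup ∧ G.Adj v₁ a ∧ G.Adj v₁ b ∧ G.Adj a v₂ ∧ G.Adj b v₃

/-- Here the two parts `A i` and `A j` may coincide. -/
def B8 (G : SimpleGraph V) (A : Fin ℓ → Set V) : Prop :=
  ∃ i j, ∃ v₁ ∈ free A, ∃ v₂ ∈ free A, ∃ v₃ ∈ free A, ∃ a ∈ A i, ∃ b ∈ A j, a ≠ b ∧
    [v₁, v₂, v₃].Nodup ∧ G.Adj v₁ a ∧ G.Adj a v₂ ∧ G.Adj v₁ v₃ ∧ G.Adj v₃ b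

/-- Some branching rule is applicable. -/
def BranchingApplicable (G : SimpleGraph V) (A : Fin ℓ → Set V) : Prop :=
  B1 G A ∨ B2 G A ∨ B3 G A ∨ B4 G A ∨ B4' G A ∨ B5 G A ∨ B6 G A ∨ B7 G A ∨ B8 G A

/-! The partition constructed when no rule is applicable. -/

/-- `A'_i`: the vertices of `A i` with at least two free neighbours. -/
def partPrime (G : SimpleGraph V) (A : Fin ℓ → Set V) (i : Fin ℓ) : Set V :=
  {v | v ∈ A i ∧ 2 ≤ degIn G (free A) v}

/-- `F'_i`: the free vertices with a neighbour in `A'_i`. -/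
def freePrime (G : SimpleGraph V) (A : Fin ℓ → Set V) (i : Fin ℓ) : Set V :=
  {v | v ∈ free A ∧ ∃ a ∈ partPrime G A i, G.Adj a v}

/-- `F''_i`: the free vertices with at least two neighbours in `F'_i`. -/
def freeSecond (G : SimpleGraph V) (A : Fin ℓ → Set V) (i : Fin ℓ) : Set V :=
  {v | v ∈ free A ∧ 2 ≤ degIn G (freePrime G A i) v}

/-- `F^*`: the free vertices in none of the sets `F'_i`, `F''_i`. -/
def freeStar (G : SimpleGraph V) (A : Fin ℓ → Set V) : Set V :=
  free A \ ⋃ i, (freePrime G A i ∪ freeSecond G A i)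

/-- `φ^*`: the part `A i` is enlarged by `F'_i` and `F''_i`, and the last part also by `F^*`. -/
def phiStar (G : SimpleGraph V) (A : Fin ℓ → Set V) (i : Fin ℓ) : Set V :=
  A i ∪ freePrime G A i ∪ freeSecond G A i ∪ {v | (i : ℕ) + 1 = ℓ ∧ v ∈ freeStar G A}

end Graph

/-! ### Machine model

Algorithms are first-order recursive functional programs over binary trees (`cons` cells), and
the running time is the number of evaluation steps, every elementary operation costing one step.
Programs are finite and fixed, so this is a pointer machine: it and a random-access machine with
logarithmic cost simulate each other with an overhead factor polynomial in the logarithm of the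
running time, hence polynomial in `n` for running times `2 ^ poly(n)`. -/

/-- Binary trees, the data of the machine. -/
inductive Data : Type
  | nil : Data
  | cons (a b : Data) : Data

/-- Expressions. Variables are de Bruijn indices into the current environment. -/
inductive Expr : Type
  | var (k : ℕ) : Expr
  | nil : Expr
  | cons (e₁ e₂ : Expr) : Expr
  /-- evaluate `e`, then `b` in the environment extended by the value of `e` -/
  | letIn (e b : Expr) : Expr
  /-- evaluate `e`; if the value is `nil` continue with `n`, if it is `cons a b` continue with `c`
  in the environment extended by `a` and `b` -/
  | caseOf (e n c : Expr) : Expr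
  /-- call the `f`-th function of the program on the value of `e` -/
  | call (f : ℕ) (e : Expr) : Expr

/-- A program: a finite list of mutually recursive unary functions, and a main expression. Bodies
are evaluated in the environment that holds just the argument. -/
structure Program : Type where
  functions : List Expr
  main : Expr

/-- `Eval fs env e v t`: in the environment `env` the expression `e` evaluates to `v` in exactly
`t` steps, where `fs` is the list of function bodies. -/
inductive Eval (fs : List Expr) : List Data → Expr → Data → ℕ → Prop
  | var {env : List Data} {k : ℕ} {v : Data} (h : env[k]? = some v) : Eval fs env (.var k) v 1
  | nil {env : List Data} : Eval fs env .nil .nil 1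
  | cons {env : List Data} {e₁ e₂ : Expr} {v₁ v₂ : Data} {t₁ t₂ : ℕ}
      (h₁ : Eval fs env e₁ v₁ t₁) (h₂ : Eval fs env e₂ v₂ t₂) :
      Eval fs env (.cons e₁ e₂) (.cons v₁ v₂) (t₁ + t₂ + 1)
  | letIn {env : List Data} {e b : Expr} {v w : Data} {t₁ t₂ : ℕ}
      (h₁ : Eval fs env e v t₁) (h₂ : Eval fs (v :: env) b w t₂) :
      Eval fs env (.letIn e b) w (t₁ + t₂ + 1)
  | caseNil {env : List Data} {e n c : Expr} {w : Data} {t₁ t₂ : ℕ}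
      (h₁ : Eval fs env e .nil t₁) (h₂ : Eval fs env n w t₂) :
      Eval fs env (.caseOf e n c) w (t₁ + t₂ + 1)
  | caseCons {env : List Data} {e n c : Expr} {a b w : Data} {t₁ t₂ : ℕ}
      (h₁ : Eval fs env e (.cons a b) t₁) (h₂ : Eval fs (a :: b :: env) c w t₂) :
      Eval fs env (.caseOf e n c) w (t₁ + t₂ + 1)
  | call {env : List Data} {f : ℕ} {e body : Expr} {v w : Data} {t₁ t₂ : ℕ}
      (hf : fs[f]? = some body) (h₁ : Eval fs env e v t₁) (h₂ : Eval fs [v] body w t₂) :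
      Eval fs env (.call f e) w (t₁ + t₂ + 1)

/-- On the given input the program halts with the given output after exactly `t` steps. -/
def Program.Runs (P : Program) (input output : Data) (t : ℕ) : Prop :=
  Eval P.functions [input] P.main output t

/-- Lists as `nil`-terminated chains of `cons` cells. -/
def encodeList : List Data → Data
  | [] => .nil
  | d :: ds => .cons d (encodeList ds)

open Classical in
/-- A truth value: `nil` for false, `cons nil nil` for true. -/
noncomputable def encodeProp (p : Prop) : Data :=
  if p then .cons .nil .nil else .nil

/-- A number in binary, least significant bit first. -/
noncomputable def encodeNat (m : ℕ) : Data :=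
  encodeList (m.bits.map fun b => encodeProp (b = true))

/-- A graph on `n` vertices as its adjacency matrix, a list of `n` rows of `n` bits. -/
noncomputable def encodeGraph {n : ℕ} (G : SimpleGraph (Fin n)) : Data :=
  encodeList (List.ofFn fun i => encodeList (List.ofFn fun j => encodeProp (G.Adj i j)))

/-- An instance of Matching Multicut. -/
noncomputable def encodeInstance {n : ℕ} (G : SimpleGraph (Fin n)) (ℓ : ℕ) : Data :=
  .cons (encodeGraph G) (encodeNat ℓ)

end MatchingMulticut

/-!
For the first statement, assume that no rule is applicable. Rules S1 and R2 leave every free vertex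
with at most one neighbour in each part. A vertex of `F'_i` has exactly two neighbours, one in
`A i` and one that is free or in another part (`neighborSet_of_mem_freePrime`). Rules B7 and R4 make
the sets `F'_i` disjoint, rules R5, B8 and B4' force all neighbours of a vertex of `F''_i` into
`F'_i` (`mem_freePrime_of_adj_freeSecond`), and a vertex of `F^*` with two neighbours outside the
last part would be a configuration of R6, B3, B4, R7 or B8 (`eq_of_adj_freeStar`).

The algorithm for the second statement does not use these rules. It grows classes of vertices
known to be in the same part, where all vertices not yet in a class are called free and count as one
more class. If a vertex `v` has two neighbours `x` and `y` outside its class, then one of them is in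
the part of `v`, so the search branches into merging `v` with `x` and merging `v` with `y`. If there
is no such vertex, the classes form a matching multicut, and it remains to count them. The search
tree is binary, so only its depth matters, that is, the number of mergings.

* For `ℓ ≤ 3` parts, one seed is chosen in each part except a largest one, and the vertices of that
  part remain free. Every merging moves a free vertex out of the free class or unites two classes,
  so `n - n / ℓ` mergings suffice. This gives `2 ^ (n / 2) = √2 ^ n` for `ℓ = 2` and
  `2 ^ (2 n / 3) ≤ √3 ^ n` for `ℓ = 3`, with at most `n ^ 2` choices of seeds.
* For `ℓ ≥ 4`, the search starts with the classes of one vertex each, and `n` mergings suffice, which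
  gives `2 ^ n = √4 ^ n` with no choice of seeds.

So `α ℓ = √(min ℓ 4)` is possible. Completeness is `accepts_of_compatible`: if the classes are
compatible with a solution, then one of the two mergings keeps them so and lowers the number of
`pending` labels, those of the vertices that are not free or have to leave the free class.

The search is carried out on lists of labels by the functions `Accepts` and `AcceptsSeeded`. The
expressions `acceptsCode`, `seededCode` and so on are their translations to the machine, and the
lemmas `evalsIn_…` and `exists_eval_…` show, by induction along the recursion, that the translations
are correct and how long they take.
-/

namespace MatchingMulticut

/-! ### The partition `phiStar` when no rule applies -/

section Structure

variable {V : Type*} {G : SimpleGraph V} {ℓ : ℕ} {A : Fin ℓ → Set V}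

theorem mem_free_or_exists_mem (v : V) : v ∈ free A ∨ ∃ i, v ∈ A i := by
  by_cases h : ∃ i, v ∈ A i
  · exact Or.inr h
  · exact Or.inl fun i hi => h ⟨i, hi⟩

theorem deg_eq_two {v x y : V} (hne : x ≠ y) (h : G.neighborSet v = {x, y}) : deg G v = 2 := by
  rw [deg, h, Set.ncard_pair hne]

/-- An assigned vertex with a free neighbour has no neighbour in another part. -/
theorem part_eq_of_adj_free (hR : ¬ ReductionApplicable G A) {u v x : V} {i j : Fin ℓ}
    (hu : u ∈ A i) (hx : x ∈ free A) (hux : G.Adj u x) (huv : G.Adj u v) (hv : v ∈ A j) :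
    j = i := by
  by_contra hne
  exact hR (Or.inr (Or.inr (Or.inl ⟨i, j, Ne.symm hne, u, hu, v, hv, huv, Or.inl ⟨x, hux, hx⟩⟩)))

theorem index_eq_of_mem_part (hdis : ∀ i j, i ≠ j → Disjoint (A i) (A j)) {v : V} {i j : Fin ℓ}
    (hi : v ∈ A i) (hj : v ∈ A j) : i = j := by
  by_contra h
  exact Set.disjoint_left.1 (hdis i j h) hi hj

theorem exists_mem_phiStar (hℓ : 1 ≤ ℓ) (v : V) : ∃ i, v ∈ phiStar G A i := by
  rcases mem_free_or_exists_mem (A := A) v with hF | ⟨i, hi⟩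
  · by_cases h : v ∈ ⋃ i, (freePrime G A i ∪ freeSecond G A i)
    · obtain ⟨i, hi | hi⟩ := Set.mem_iUnion.1 h
      · exact ⟨i, Or.inl (Or.inl (Or.inr hi))⟩
      · exact ⟨i, Or.inl (Or.inr hi)⟩
    · exact ⟨⟨ℓ - 1, by omega⟩, Or.inr ⟨by simp; omega, hF, h⟩⟩
  · exact ⟨i, Or.inl (Or.inl (Or.inl hi))⟩

variable [Finite V]

theorem two_le_degIn_iff {S : Set V} {v : V} :
    2 ≤ degIn G S v ↔ ∃ x y, x ≠ y ∧ (G.Adj v x ∧ x ∈ S) ∧ (G.Adj v y ∧ y ∈ S) := by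
  rw [degIn, ← Nat.lt_iff_add_one_le, Set.one_lt_ncard_iff (Set.toFinite _)]
  constructor
  · rintro ⟨x, y, hx, hy, hne⟩
    exact ⟨x, y, hne, hx, hy⟩
  · rintro ⟨x, y, hne, hx, hy⟩
    exact ⟨x, y, hx, hy, hne⟩

theorem one_le_degIn {S : Set V} {v x : V} (h : G.Adj v x) (hx : x ∈ S) : 1 ≤ degIn G S v :=
  (Set.ncard_pos (Set.toFinite _)).2 ⟨x, h, hx⟩

theorem eq_of_degIn_lt_two {S : Set V} {v x y : V} (h : ¬ 2 ≤ degIn G S v)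
    (hx : G.Adj v x) (hxS : x ∈ S) (hy : G.Adj v y) (hyS : y ∈ S) : x = y := by
  by_contra hne
  exact h (two_le_degIn_iff.2 ⟨x, y, hne, ⟨hx, hxS⟩, ⟨hy, hyS⟩⟩)

theorem exists_adj_ne_of_two_le_deg {v : V} (h : 2 ≤ deg G v) (x : V) :
    ∃ y, G.Adj v y ∧ y ≠ x := by
  obtain ⟨p, q, hp, hq, hne⟩ :=
    (Set.one_lt_ncard_iff (Set.toFinite (G.neighborSet v))).1 (show 1 < _ from h)
  by_cases hpx : p = x
  · exact ⟨q, hq, fun hqx => hne (hpx.trans hqx.symm)⟩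
  · exact ⟨p, hp, hpx⟩

/-- If no rule is applicable then every free vertex has at most one neighbour in each part. -/
theorem eq_of_adj_part (hS : ¬ StoppingApplicable G A) (hR : ¬ ReductionApplicable G A)
    {v x y : V} {i : Fin ℓ} (hv : v ∈ free A) (hx : G.Adj v x) (hxi : x ∈ A i)
    (hy : G.Adj v y) (hyi : y ∈ A i) : x = y := by
  refine eq_of_degIn_lt_two (fun h2 => ?_) hx hxi hy hyi
  refine hR (Or.inr (Or.inl ⟨v, hv, i, h2, fun j hj => ?_⟩))
  by_contra hne
  exact hS (Or.inl ⟨v, hv, j, i, hne, hj, h2⟩)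

/-- If no rule is applicable then the neighbours of a free vertex lie in at most two parts. -/
theorem part_eq_or_eq (hS : ¬ StoppingApplicable G A) {v x y z : V} {i j k : Fin ℓ}
    (hv : v ∈ free A) (hx : G.Adj v x) (hxi : x ∈ A i) (hy : G.Adj v y) (hyj : y ∈ A j)
    (hij : i ≠ j) (hz : G.Adj v z) (hzk : z ∈ A k) : k = i ∨ k = j := by
  by_contra h
  push Not at h
  exact hS (Or.inr (Or.inl ⟨v, hv, i, j, k, hij, h.1.symm, h.2.symm, one_le_degIn hx hxi,
    one_le_degIn hy hyj, one_le_degIn hz hzk⟩))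

/-- A vertex of `F'_i` is joined to a vertex `a` of `A i` that has another free neighbour. -/
theorem exists_of_mem_freePrime {v : V} {i : Fin ℓ} (hv : v ∈ freePrime G A i) :
    ∃ a ∈ A i, ∃ v', v' ≠ v ∧ G.Adj a v ∧ G.Adj a v' ∧ v' ∈ free A ∧ v' ∈ freePrime G A i := by
  obtain ⟨hvF, a, ha, hav⟩ := hv
  obtain ⟨p, q, hne, ⟨hp, hpF⟩, ⟨hq, hqF⟩⟩ := two_le_degIn_iff.1 ha.2
  by_cases hpv : p = v
  · exact ⟨a, ha.1, q, fun h => hne (hpv.trans h.symm), hav, hq, hqF, hqF, a, ha, hq⟩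
  · exact ⟨a, ha.1, p, hpv, hav, hp, hpF, hpF, a, ha, hp⟩

/-- The neighbours of a vertex of `F'_i` when no rule is applicable: one of them is a vertex `a` of
`A i` with a further free neighbour, and there is exactly one other, which is free or lies in
another part. -/
theorem neighborSet_of_mem_freePrime (hdeg : ∀ v, 2 ≤ deg G v)
    (hS : ¬ StoppingApplicable G A) (hR : ¬ ReductionApplicable G A)
    (hB : ¬ BranchingApplicable G A) {v : V} {i : Fin ℓ} (hv : v ∈ freePrime G A i) :
    ∃ a ∈ A i, ∃ v', v' ≠ v ∧ G.Adj a v ∧ G.Adj a v' ∧ v' ∈ free A ∧ v' ∈ freePrime G A i ∧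
      ∃ x, x ≠ a ∧ G.neighborSet v = {a, x} ∧ (x ∈ free A ∨ ∃ j, j ≠ i ∧ x ∈ A j) := by
  obtain ⟨a, ha, v', hne, hav, hav', hv'F, hv'⟩ := exists_of_mem_freePrime hv
  refine ⟨a, ha, v', hne, hav, hav', hv'F, hv', ?_⟩
  have hvF := hv.1
  obtain ⟨x, hvx, hxa⟩ := exists_adj_ne_of_two_le_deg (hdeg v) a
  have hnadj : ¬ G.Adj v v' := fun h =>
    hR (Or.inl ⟨i, a, ha, v, hvF, v', hv'F, hav, hav', h⟩)
  -- rule B1 leaves at most one free neighbour, rule B3 none beside a neighbour in another part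
  have hfree : ∀ p q, G.Adj v p → p ∈ free A → G.Adj v q → q ∈ free A → p = q := by
    intro p q hp hpF hq hqF
    by_contra hpq
    refine hB (Or.inl ⟨i, v, hvF, v', hv'F, p, hpF, q, hqF, a, ha, ?_, hav.symm, hav', hp, hq⟩)
    have h1 : v' ≠ p := by rintro rfl; exact hnadj hp
    have h2 : v' ≠ q := by rintro rfl; exact hnadj hq
    simp [hne.symm, hp.ne, hq.ne, h1, h2, hpq]
  have hmixed : ∀ p q j, j ≠ i → G.Adj v p → p ∈ A j → G.Adj v q → q ∈ free A → False := by
    intro p q j hj hp hpA hq hqF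
    exact hB (Or.inr (Or.inr (Or.inl ⟨i, j, hj.symm, v, hvF, q, hqF, a, ha, p, hpA, hq,
      hav.symm, hp⟩)))
  have hpart : ∀ p j, G.Adj v p → p ∈ A j → p ≠ a → j ≠ i := by
    rintro p j hp hpA hpa rfl
    exact hpa (eq_of_adj_part hS hR hvF hp hpA hav.symm ha)
  rcases mem_free_or_exists_mem (A := A) x with hxF | ⟨j, hxj⟩
  · refine ⟨x, hxa, ?_, Or.inl hxF⟩
    ext y
    simp only [SimpleGraph.mem_neighborSet, Set.mem_insert_iff, Set.mem_singleton_iff]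
    refine ⟨fun hy => ?_, ?_⟩
    · rcases mem_free_or_exists_mem (A := A) y with hyF | ⟨k, hyk⟩
      · exact Or.inr (hfree y x hy hyF hvx hxF)
      · by_contra h
        push Not at h
        exact hmixed y x k (hpart y k hy hyk h.1) hy hyk hvx hxF
    · rintro (rfl | rfl)
      exacts [hav.symm, hvx]
  · have hji := hpart x j hvx hxj hxa
    refine ⟨x, hxa, ?_, Or.inr ⟨j, hji, hxj⟩⟩
    ext y
    simp only [SimpleGraph.mem_neighborSet, Set.mem_insert_iff, Set.mem_singleton_iff]
    refine ⟨fun hy => ?_, ?_⟩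
    · rcases mem_free_or_exists_mem (A := A) y with hyF | ⟨k, hyk⟩
      · exact (hmixed x y j hji hvx hxj hy hyF).elim
      · rcases part_eq_or_eq hS hvF hav.symm ha hvx hxj hji.symm hy hyk with rfl | rfl
        · exact Or.inl (eq_of_adj_part hS hR hvF hy hyk hav.symm ha)
        · exact Or.inr (eq_of_adj_part hS hR hvF hy hyk hvx hxj)
    · rintro (rfl | rfl)
      exacts [hav.symm, hvx]

theorem index_eq_of_mem_freePrime (hdeg : ∀ v, 2 ≤ deg G v)
    (hdis : ∀ i j, i ≠ j → Disjoint (A i) (A j))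
    (hS : ¬ StoppingApplicable G A) (hR : ¬ ReductionApplicable G A)
    (hB : ¬ BranchingApplicable G A) {v : V} {i j : Fin ℓ} (hi : v ∈ freePrime G A i)
    (hj : v ∈ freePrime G A j) : i = j := by
  by_contra hij
  have hvF := hi.1
  obtain ⟨a, ha, v₂, hv₂, hav, hav₂, hv₂F, hv₂i, x, -, hN, -⟩ :=
    neighborSet_of_mem_freePrime hdeg hS hR hB hi
  obtain ⟨b, hb, v₃, hv₃, hbv, hbv₃, hv₃F, -⟩ := exists_of_mem_freePrime hj
  have hab : b ≠ a := by rintro rfl; exact hij (index_eq_of_mem_part hdis ha hb)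
  have hbx : b = x := by
    have : b ∈ G.neighborSet v := hbv.symm
    rw [hN] at this
    exact this.resolve_left hab
  subst hbx
  -- by rule B7 the other free neighbours of `a` and of `b` agree, which makes them a twin of `v`
  by_cases h23 : v₂ = v₃
  · subst h23
    obtain ⟨a', ha', -, -, ha'v₂, -, -, -, y, -, hN', -⟩ :=
      neighborSet_of_mem_freePrime hdeg hS hR hB hv₂i
    have haa' : a' = a := eq_of_adj_part hS hR hv₂F ha'v₂.symm ha' hav₂.symm ha
    subst haa'
    have hby : b = y := by
      have : b ∈ G.neighborSet v₂ := hbv₃.symm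
      rw [hN'] at this
      exact this.resolve_left hab
    subst hby
    exact hR (Or.inr (Or.inr (Or.inr (Or.inl
      ⟨i, j, hij, v, hvF, v₂, hv₂F, hv₂.symm, a', ha, b, hb, hN, hN'⟩))))
  · refine hB (Or.inr (Or.inr (Or.inr (Or.inr (Or.inr (Or.inr (Or.inr (Or.inl
      ⟨i, j, hij, v, hvF, v₂, hv₂F, v₃, hv₃F, a, ha, b, hb, ?_, hav.symm, hbv.symm, hav₂,
        hbv₃⟩))))))))
    simp [hv₂.symm, hv₃.symm, h23]

/-- A free vertex outside `F'_i` with a neighbour in `F'_i` has no assigned neighbour, by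
rule B8. -/
theorem not_adj_part_of_adj_freePrime (hdeg : ∀ v, 2 ≤ deg G v)
    (hS : ¬ StoppingApplicable G A) (hR : ¬ ReductionApplicable G A)
    (hB : ¬ BranchingApplicable G A) {v p b : V} {i j : Fin ℓ} (hv : v ∈ free A)
    (hvi : v ∉ freePrime G A i) (hp : p ∈ freePrime G A i) (hvp : G.Adj v p)
    (hb : b ∈ A j) : ¬ G.Adj v b := by
  intro hvb
  obtain ⟨a, ha, p', hne, hap, hap', hp'F, hp', -⟩ :=
    neighborSet_of_mem_freePrime hdeg hS hR hB hp
  have hab : a ≠ b := by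
    rintro rfl
    exact hR (Or.inl ⟨i, a, ha, v, hv, p, hp.1, hvb.symm, hap, hvp⟩)
  have hp'v : p' ≠ v := by rintro rfl; exact hvi hp'
  refine hB (Or.inr (Or.inr (Or.inr (Or.inr (Or.inr (Or.inr (Or.inr (Or.inr
    ⟨i, j, p, hp.1, p', hp'F, v, hv, a, ha, b, hb, hab, ?_, hap.symm, hap', hvp.symm, hvb⟩))))))))
  simp [hne.symm, hvp.ne.symm, hp'v]

/-- If the vertex `p` of `F'_i` has a free neighbour `v`, then `v` is its only neighbour besides
the vertex `a` of `A i`. -/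
theorem neighborSet_of_adj_freePrime (hdeg : ∀ v, 2 ≤ deg G v)
    (hS : ¬ StoppingApplicable G A) (hR : ¬ ReductionApplicable G A)
    (hB : ¬ BranchingApplicable G A) {v p : V} {i : Fin ℓ} (hv : v ∈ free A)
    (hp : p ∈ freePrime G A i) (hvp : G.Adj v p) :
    ∃ a ∈ A i, ∃ p', p' ≠ p ∧ G.Adj a p ∧ G.Adj a p' ∧ p' ∈ free A ∧ p' ∈ freePrime G A i ∧
      a ≠ v ∧ G.neighborSet p = {a, v} := by
  obtain ⟨a, ha, p', hne, hap, hap', hp'F, hp', x, -, hN, -⟩ :=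
    neighborSet_of_mem_freePrime hdeg hS hR hB hp
  have hav : a ≠ v := by rintro rfl; exact hv i ha
  have : v ∈ G.neighborSet p := hvp.symm
  rw [hN] at this
  obtain rfl : v = x := this.resolve_left hav.symm
  exact ⟨a, ha, p', hne, hap, hap', hp'F, hp', hav, hN⟩

/-- A vertex of `F'_i` has at most one free neighbour, so it is in no set `F''_j`. -/
theorem not_mem_freeSecond_of_mem_freePrime (hdeg : ∀ v, 2 ≤ deg G v)
    (hS : ¬ StoppingApplicable G A) (hR : ¬ ReductionApplicable G A)
    (hB : ¬ BranchingApplicable G A) {v : V} {i j : Fin ℓ} (hv : v ∈ freePrime G A i) :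
    v ∉ freeSecond G A j := by
  rintro ⟨-, h2⟩
  obtain ⟨p, q, hne, ⟨hp, hpj⟩, ⟨hq, hqj⟩⟩ := two_le_degIn_iff.1 h2
  obtain ⟨a, ha, -, -, -, -, -, -, x, -, hN, -⟩ := neighborSet_of_mem_freePrime hdeg hS hR hB hv
  have hp' : p ∈ G.neighborSet v := hp
  have hq' : q ∈ G.neighborSet v := hq
  rw [hN] at hp' hq'
  have hpa : p ≠ a := by rintro rfl; exact hpj.1 i ha
  have hqa : q ≠ a := by rintro rfl; exact hqj.1 i ha
  exact hne ((hp'.resolve_left hpa).trans (hq'.resolve_left hqa).symm)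

/-- All neighbours of a vertex of `F''_i` are in `F'_i`: by rule B8 they are free, and by
rule B4' there is none outside `F'_i`. -/
theorem mem_freePrime_of_adj_freeSecond (hdeg : ∀ v, 2 ≤ deg G v)
    (hS : ¬ StoppingApplicable G A) (hR : ¬ ReductionApplicable G A)
    (hB : ¬ BranchingApplicable G A) {v w : V} {i : Fin ℓ} (hv : v ∈ freeSecond G A i)
    (hvw : G.Adj v w) : w ∈ freePrime G A i := by
  obtain ⟨hvF, h2⟩ := hv
  obtain ⟨p, q, hpq, ⟨hvp, hp⟩, ⟨hvq, hq⟩⟩ := two_le_degIn_iff.1 h2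
  have hvn : ∀ k, v ∉ freePrime G A k := fun k hk =>
    not_mem_freeSecond_of_mem_freePrime hdeg hS hR hB hk ⟨hvF, h2⟩
  have hwF : w ∈ free A := fun j hj =>
    not_adj_part_of_adj_freePrime hdeg hS hR hB hvF (hvn i) hp hvp hj hvw
  obtain ⟨a, ha, p', hp'p, hap, hap', hp'F, hp', hav, hNp⟩ :=
    neighborSet_of_adj_freePrime hdeg hS hR hB hvF hp hvp
  obtain ⟨a', ha', q', hq'q, haq, haq', hq'F, hq', ha'v, hNq⟩ :=
    neighborSet_of_adj_freePrime hdeg hS hR hB hvF hq hvq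
  by_contra hw
  have haa : a ≠ a' := by
    rintro rfl
    exact hR (Or.inr (Or.inr (Or.inr (Or.inr (Or.inl
      ⟨i, p, hp.1, q, hq.1, hpq, a, ha, v, hvF, hNp, hNq⟩)))))
  have hcom : ∀ z, z ∈ free A → G.Adj a z → ¬ G.Adj a' z := fun z hz h h' =>
    haa (eq_of_adj_part hS hR hz h.symm ha h'.symm ha')
  have ne_of : ∀ z, z ∈ freePrime G A i → w ≠ z := by rintro z hz rfl; exact hw hz
  have vne_of : ∀ z, z ∈ freePrime G A i → v ≠ z := by rintro z hz rfl; exact hvn i hz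
  refine hB (Or.inr (Or.inr (Or.inr (Or.inr (Or.inl
    ⟨i, v, hvF, p, hp.1, q, hq.1, w, hwF, p', hp'F, q', hq'F, a, ha, a', ha', haa, ?_,
      hvp, hvq, hvw, hap.symm, hap', haq.symm, haq'⟩)))))
  have h1 : p ≠ q' := by rintro rfl; exact hcom p hp.1 hap haq'
  have h2 : q ≠ p' := by rintro rfl; exact hcom q hq.1 hap' haq
  have h3 : p' ≠ q' := by rintro rfl; exact hcom p' hp'F hap' haq'
  simp [hvw.ne, vne_of p hp, vne_of q hq, vne_of p' hp', vne_of q' hq', hpq, (ne_of p hp).symm,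
    (ne_of q hq).symm, ne_of p' hp', ne_of q' hq', hp'p.symm, hq'q.symm, h1, h2, h3]

/-- When no rule is applicable, the part that receives a vertex is determined: the sets
`phiStar G A i` are disjoint. -/
theorem index_eq_of_mem_phiStar (hdeg : ∀ v, 2 ≤ deg G v)
    (hdis : ∀ i j, i ≠ j → Disjoint (A i) (A j))
    (hS : ¬ StoppingApplicable G A) (hR : ¬ ReductionApplicable G A)
    (hB : ¬ BranchingApplicable G A) {v : V} {i j : Fin ℓ} (hi : v ∈ phiStar G A i)
    (hj : v ∈ phiStar G A j) : i = j := by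
  have hPS := fun {k m} (h : v ∈ freePrime G A k) (h' : v ∈ freeSecond G A m) =>
    not_mem_freeSecond_of_mem_freePrime hdeg hS hR hB h h'
  have hstar : ∀ k, v ∈ freeStar G A → v ∉ freePrime G A k ∧ v ∉ freeSecond G A k := by
    intro k hk
    exact ⟨fun h => hk.2 (Set.mem_iUnion.2 ⟨k, Or.inl h⟩),
      fun h => hk.2 (Set.mem_iUnion.2 ⟨k, Or.inr h⟩)⟩
  rcases hi with ((hi | hi) | hi) | ⟨hi', hi⟩ <;> rcases hj with ((hj | hj) | hj) | ⟨hj', hj⟩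
  · exact index_eq_of_mem_part hdis hi hj
  · exact (hj.1 i hi).elim
  · exact (hj.1 i hi).elim
  · exact (hj.1 i hi).elim
  · exact (hi.1 j hj).elim
  · exact index_eq_of_mem_freePrime hdeg hdis hS hR hB hi hj
  · exact (hPS hi hj).elim
  · exact ((hstar i hj).1 hi).elim
  · exact (hi.1 j hj).elim
  · exact (hPS hj hi).elim
  · obtain ⟨p, q, -, ⟨hp, -⟩, -⟩ := two_le_degIn_iff.1 hi.2
    exact index_eq_of_mem_freePrime hdeg hdis hS hR hB
      (mem_freePrime_of_adj_freeSecond hdeg hS hR hB hi hp)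
      (mem_freePrime_of_adj_freeSecond hdeg hS hR hB hj hp)
  · exact ((hstar i hj).2 hi).elim
  · exact (hi.1 j hj).elim
  · exact ((hstar j hi).1 hj).elim
  · exact ((hstar j hi).2 hj).elim
  · exact Fin.ext (by omega)

/-- A vertex of `F^*` has at most one neighbour outside the last part. -/
theorem eq_of_adj_freeStar (hdeg : ∀ v, 2 ≤ deg G v)
    (hdis : ∀ i j, i ≠ j → Disjoint (A i) (A j))
    (hS : ¬ StoppingApplicable G A) (hR : ¬ ReductionApplicable G A)
    (hB : ¬ BranchingApplicable G A) {v p q : V} (hv : v ∈ freeStar G A)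
    {i j : Fin ℓ} (hvp : G.Adj v p) (hvq : G.Adj v q) (hp : p ∈ A i ∪ freePrime G A i)
    (hq : q ∈ A j ∪ freePrime G A j) : p = q := by
  have hvF := hv.1
  have hvn : ∀ k, v ∉ freePrime G A k := fun k h => hv.2 (Set.mem_iUnion.2 ⟨k, Or.inl h⟩)
  have hvn2 : ∀ k, v ∉ freeSecond G A k := fun k h => hv.2 (Set.mem_iUnion.2 ⟨k, Or.inr h⟩)
  have honly : ∀ a k, a ∈ A k → G.Adj v a → G.neighborSet a ⊆ A k ∪ {v} := by
    intro a k ha hva z hz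
    rcases mem_free_or_exists_mem (A := A) z with hzF | ⟨m, hm⟩
    · by_contra hzv
      have hzv' : z ≠ v := fun h => hzv (Or.inr h)
      exact hvn k ⟨hvF, a, ⟨ha, two_le_degIn_iff.2
        ⟨z, v, hzv', ⟨hz, hzF⟩, ⟨hva.symm, hvF⟩⟩⟩, hva.symm⟩
    · obtain rfl := part_eq_of_adj_free hR ha hvF hva.symm hz hm
      exact Or.inl hm
  by_contra hne
  rcases hp with hp | hp <;> rcases hq with hq | hq
  · have hij : i ≠ j := by
      rintro rfl
      exact hne (eq_of_adj_part hS hR hvF hvp hp hvq hq)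
    refine hR (Or.inr (Or.inr (Or.inr (Or.inr (Or.inr (Or.inl
      ⟨i, j, hij, v, hvF, p, hp, q, hq, ?_, honly p i hp hvp, honly q j hq hvq⟩))))))
    ext z
    simp only [SimpleGraph.mem_neighborSet, Set.mem_insert_iff, Set.mem_singleton_iff]
    refine ⟨fun hz => ?_, ?_⟩
    · rcases mem_free_or_exists_mem (A := A) z with hzF | ⟨m, hm⟩
      · exact (hB (Or.inr (Or.inr (Or.inl
          ⟨i, j, hij, v, hvF, z, hzF, p, hp, q, hq, hz, hvp, hvq⟩)))).elim
      · rcases part_eq_or_eq hS hvF hvp hp hvq hq hij hz hm with rfl | rfl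
        · exact Or.inl (eq_of_adj_part hS hR hvF hz hm hvp hp)
        · exact Or.inr (eq_of_adj_part hS hR hvF hz hm hvq hq)
    · rintro (rfl | rfl)
      exacts [hvp, hvq]
  · exact not_adj_part_of_adj_freePrime hdeg hS hR hB hvF (hvn j) hq hvq hp hvp
  · exact not_adj_part_of_adj_freePrime hdeg hS hR hB hvF (hvn i) hp hvp hq hvq
  · have hij : i ≠ j := by
      rintro rfl
      exact hvn2 i ⟨hvF, two_le_degIn_iff.2 ⟨p, q, hne, ⟨hvp, hp⟩, ⟨hvq, hq⟩⟩⟩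
    obtain ⟨a, ha, p', hp'p, hap, hap', hp'F, hp', hav, hNp⟩ :=
      neighborSet_of_adj_freePrime hdeg hS hR hB hvF hp hvp
    obtain ⟨b, hb, q', hq'q, hbq, hbq', hq'F, hq', hbv, hNq⟩ :=
      neighborSet_of_adj_freePrime hdeg hS hR hB hvF hq hvq
    have ne_of : ∀ y z, y ∈ freePrime G A i → z ∈ freePrime G A j → y ≠ z := by
      rintro y z hy hz rfl
      exact hij (index_eq_of_mem_freePrime hdeg hdis hS hR hB hy hz)
    have vne_of : ∀ k z, z ∈ freePrime G A k → v ≠ z := by rintro k z hz rfl; exact hvn k hz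
    have huniq : ∀ k y z, y ∈ freePrime G A k → z ∈ freePrime G A k → G.Adj v y → G.Adj v z →
        y = z := by
      intro k y z hy hz hvy hvz
      by_contra hyz
      exact hvn2 k ⟨hvF, two_le_degIn_iff.2 ⟨y, z, hyz, ⟨hvy, hy⟩, ⟨hvz, hz⟩⟩⟩
    -- by rule B4, `v` has no third neighbour, so that rule R7 is applicable
    have hNv : G.neighborSet v = {p, q} := by
      ext z
      simp only [SimpleGraph.mem_neighborSet, Set.mem_insert_iff, Set.mem_singleton_iff]
      refine ⟨fun hz => ?_, ?_⟩
      · by_contra hzn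
        push Not at hzn
        have hzF : z ∈ free A := fun k hk =>
          not_adj_part_of_adj_freePrime hdeg hS hR hB hvF (hvn i) hp hvp hk hz
        have hzp' : z ≠ p' := by rintro rfl; exact hzn.1 (huniq i z p hp' hp hz hvp)
        have hzq' : z ≠ q' := by rintro rfl; exact hzn.2 (huniq j z q hq' hq hz hvq)
        refine hB (Or.inr (Or.inr (Or.inr (Or.inl ⟨i, j, hij, v, hvF, p, hp.1, q, hq.1, z, hzF,
          p', hp'F, q', hq'F, a, ha, b, hb, ?_, hvp, hvq, hz, hap.symm, hap', hbq.symm, hbq'⟩))))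
        simp [hvp.ne, hvq.ne, hz.ne, vne_of i p' hp', vne_of j q' hq', hne,
          Ne.symm hzn.1, Ne.symm hzn.2, hp'p.symm, hq'q.symm, ne_of p q' hp hq',
          (ne_of p' q hp' hq).symm, ne_of p' q' hp' hq', hzp', hzq']
      · rintro (rfl | rfl)
        exacts [hvp, hvq]
    refine hR (Or.inr (Or.inr (Or.inr (Or.inr (Or.inr (Or.inr
      ⟨i, j, hij, v, hvF, p, hp.1, q, hq.1, p', hp'F, q', hq'F, a, ha, b, hb, ?_,
        deg_eq_two hne hNv, deg_eq_two hav hNp, deg_eq_two hbv hNq, hvp, hvq, hap.symm, hap',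
        hbq.symm, hbq'⟩))))))
    simp [hvp.ne, hvq.ne, vne_of i p' hp', vne_of j q' hq', hne, hp'p.symm, hq'q.symm,
      ne_of p q' hp hq', (ne_of p' q hp' hq).symm, ne_of p' q' hp' hq']

theorem isMatchingMulticut_phiStar (hℓ : 1 ≤ ℓ) (hdeg : ∀ v, 2 ≤ deg G v)
    (hne : ∀ i, (A i).Nonempty) (hdis : ∀ i j, i ≠ j → Disjoint (A i) (A j))
    (hS : ¬ StoppingApplicable G A) (hR : ¬ ReductionApplicable G A)
    (hB : ¬ BranchingApplicable G A) : IsMatchingMulticut G (phiStar G A) where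
  nonempty i := (hne i).mono fun v hv => Or.inl (Or.inl (Or.inl hv))
  disjoint i j hij := Set.disjoint_left.2 fun v hi hj =>
    hij (index_eq_of_mem_phiStar hdeg hdis hS hR hB hi hj)
  cover := exists_mem_phiStar hℓ
  matching := by
    intro i v hv
    rw [Set.ncard_le_one (Set.toFinite _)]
    rintro p ⟨hvp, hpi⟩ q ⟨hvq, hqi⟩
    have hvp : G.Adj v p := hvp
    have hvq : G.Adj v q := hvq
    rcases hv with ((hv | hv) | hv) | ⟨hi, hv⟩
    · have hnA : ∀ z, z ∉ phiStar G A i → z ∉ A i := fun z hz h =>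
        hz (Or.inl (Or.inl (Or.inl h)))
      by_cases hfree : ∃ x ∈ free A, G.Adj v x
      · obtain ⟨x, hxF, hvx⟩ := hfree
        have key : ∀ z, G.Adj v z → z ∉ phiStar G A i → z ∈ free A := by
          intro z hz hzi
          rcases mem_free_or_exists_mem (A := A) z with h | ⟨k, hk⟩
          · exact h
          · obtain rfl := part_eq_of_adj_free hR hv hxF hvx hz hk
            exact (hnA z hzi hk).elim
        by_contra hpq
        refine hpi (Or.inl (Or.inl (Or.inr ⟨key p hvp hpi, v, ⟨hv, two_le_degIn_iff.2
          ⟨p, q, hpq, ⟨hvp, key p hvp hpi⟩, ⟨hvq, key q hvq hqi⟩⟩⟩, hvp⟩)))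
      · by_contra hpq
        refine hS (Or.inr (Or.inr (Or.inr ⟨i, v, hv, ?_⟩)))
        refine (Set.one_lt_ncard_iff (Set.toFinite _)).2 ⟨p, q, ⟨hvp, ?_⟩, ⟨hvq, ?_⟩, hpq⟩
        · rintro (h | h)
          exacts [hnA p hpi h, hfree ⟨p, h, hvp⟩]
        · rintro (h | h)
          exacts [hnA q hqi h, hfree ⟨q, h, hvq⟩]
    · obtain ⟨a, ha, -, -, -, -, -, -, x, -, hN, -⟩ :=
        neighborSet_of_mem_freePrime hdeg hS hR hB hv
      have key : ∀ z, G.Adj v z → z ∉ phiStar G A i → z = x := by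
        intro z hz hzi
        have hz' : z ∈ G.neighborSet v := hz
        rw [hN] at hz'
        refine hz'.resolve_left ?_
        rintro rfl
        exact hzi (Or.inl (Or.inl (Or.inl ha)))
      rw [key p hvp hpi, key q hvq hqi]
    · exact (hpi (Or.inl (Or.inl (Or.inr
        (mem_freePrime_of_adj_freeSecond hdeg hS hR hB hv hvp))))).elim
    · have key : ∀ z, G.Adj v z → z ∉ phiStar G A i → ∃ k, z ∈ A k ∪ freePrime G A k := by
        intro z hz hzi
        obtain ⟨k, ((hk | hk) | hk) | ⟨hk', hk⟩⟩ := exists_mem_phiStar (G := G) (A := A) hℓ z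
        · exact ⟨k, Or.inl hk⟩
        · exact ⟨k, Or.inr hk⟩
        · exact (hv.2 (Set.mem_iUnion.2 ⟨k, Or.inl
            (mem_freePrime_of_adj_freeSecond hdeg hS hR hB hk hz.symm)⟩)).elim
        · exact (hzi (Or.inr ⟨hi, hk⟩)).elim
      obtain ⟨k, hk⟩ := key p hvp hpi
      obtain ⟨m, hm⟩ := key q hvq hqi
      exact eq_of_adj_freeStar hdeg hdis hS hR hB hv hvp hvq hk hm

end Structure

/-! ### Matching multicuts as colourings -/

section Coloring

variable {V : Type*} {β γ : Type*} {G : SimpleGraph V}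

/-- The partition of the vertices into the colour classes of `p` has the matching property: every
vertex has at most one neighbour of another colour. -/
def IsCutColoring (G : SimpleGraph V) (p : V → β) : Prop :=
  ∀ v x y, G.Adj v x → G.Adj v y → p x ≠ p v → p y ≠ p v → x = y

theorem IsCutColoring.comp {p : V → β} (h : IsCutColoring G p) (g : β → γ) :
    IsCutColoring G (g ∘ p) := fun v x y hx hy hpx hpy =>
  h v x y hx hy (fun e => hpx (congrArg g e)) (fun e => hpy (congrArg g e))

theorem HasMatchingMulticut.exists_coloring {ℓ : ℕ} [Finite V] (h : HasMatchingMulticut G ℓ)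
    (hℓ : 1 ≤ ℓ) : ∃ p : V → Fin ℓ, Function.Surjective p ∧ IsCutColoring G p := by
  obtain ⟨k, hk, A, hA⟩ := h
  choose p hp using hA.cover
  have hp' : ∀ v i, v ∈ A i → p v = i := by
    intro v i hi
    by_contra hne
    exact Set.disjoint_left.1 (hA.disjoint _ _ hne) (hp v) hi
  have hcut : IsCutColoring G p := by
    intro v x y hx hy hpx hpy
    refine (Set.ncard_le_one (Set.toFinite _)).1 (hA.matching (p v) v (hp v)) x ⟨hx, ?_⟩ y ⟨hy, ?_⟩
    · exact fun h => hpx (hp' x _ h)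
    · exact fun h => hpy (hp' y _ h)
  -- all parts from index `ℓ - 1` on are united
  refine ⟨(fun i : Fin k => ⟨min i (ℓ - 1), by omega⟩) ∘ p, ?_, hcut.comp _⟩
  intro i
  obtain ⟨v, hv⟩ := hA.nonempty ⟨i, by omega⟩
  refine ⟨v, ?_⟩
  rw [Function.comp_apply, hp' v _ hv]
  ext
  simp
  omega

theorem IsCutColoring.hasMatchingMulticut [Finite V] {ℓ : ℕ} {p : V → β} (h : IsCutColoring G p)
    (hℓ : ℓ ≤ (Set.range p).ncard) : HasMatchingMulticut G ℓ := by
  have e : Fin (Set.range p).ncard ≃ Set.range p :=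
    (Finite.equivFinOfCardEq (Nat.card_coe_set_eq _)).symm
  refine ⟨_, hℓ, fun i => {v | p v = e i}, ⟨?_, ?_, ?_, ?_⟩⟩
  · intro i
    obtain ⟨v, hv⟩ := (e i).2
    exact ⟨v, hv⟩
  · intro i j hij
    refine Set.disjoint_left.2 fun v hi hj => hij (e.injective (Subtype.ext ?_))
    exact (Eq.symm hi).trans hj
  · intro v
    exact ⟨e.symm ⟨p v, v, rfl⟩, by simp⟩
  · intro i v hv
    rw [Set.ncard_le_one (Set.toFinite _)]
    rintro x ⟨hx, hpx⟩ y ⟨hy, hpy⟩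
    have hv' : p v = e i := hv
    exact h v x y hx hy (by rwa [hv']) (by rwa [hv'])

end Coloring

/-! ### The branching algorithm -/

section Algorithm

open scoped Classical

/-- A vertex label: its class, which is `nil` as long as the vertex is free, and its identifier.
Free vertices have distinct labels, while vertices of one class have the same label. -/
abbrev Label : Type := Data × Data

/-- The labels, with classes other than `c`, of the vertices at which the row has a `1`. -/
noncomputable def conflicts (c : Data) : List Prop → List Label → List Label
  | b :: row, l :: L => if b ∧ l.1 ≠ c then l :: conflicts c row L else conflicts c row L
  | _, _ => []

/-- The labels of a vertex and of two neighbours whose classes differ from its own, if there are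
such. The first argument holds the labels of the vertices whose rows are given by the second. -/
noncomputable def violation (L : List Label) : List Label → List (List Prop) →
    Option (Label × Label × Label)
  | v :: vs, row :: rows =>
    match conflicts v.1 row L with
    | x :: y :: _ => some (v, x, y)
    | _ => violation L vs rows
  | _, _ => none

/-- Replace the label `s` by the label `t`. -/
noncomputable def relabel (s t : Label) (L : List Label) : List Label :=
  L.map fun l => if l = s then t else l

/-- Put the vertices with labels `v` and `x`, not both free, into the same class. -/
noncomputable def merge (v x : Label) (L : List Label) : List Label :=
  if v.1 = .nil then relabel v x L else relabel x v L

/-- The number of classes in use, where the free vertices count as one class. -/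
noncomputable def classCount : List Label → ℕ
  | [] => 0
  | l :: L => if l.1 ∈ L.map Prod.fst then classCount L else classCount L + 1

/-- The search with a bound on the number of mergings: of two neighbours of `v` in classes
different from that of `v`, one must be in the part of `v`. -/
def Accepts (rows : List (List Prop)) (ℓ : ℕ) : ℕ → List Label → Prop
  | 0, L => violation L L rows = none ∧ ℓ ≤ classCount L
  | f + 1, L =>
    match violation L L rows with
    | none => ℓ ≤ classCount L
    | some (v, x, y) => Accepts rows ℓ f (merge v x L) ∨ Accepts rows ℓ f (merge v y L)

/-- The search is carried out for all ways to turn `k` of the free vertices with labels in `S`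
into one-element classes. -/
def AcceptsSeeded (rows : List (List Prop)) (ℓ f : ℕ) : ℕ → List Label → List Label → Prop
  | 0, _, L => Accepts rows ℓ f L
  | _ + 1, [], _ => False
  | k + 1, s :: S, L => AcceptsSeeded rows ℓ f k S (relabel s (s.2, s.2) L) ∨
      AcceptsSeeded rows ℓ f (k + 1) S L

/-- The rows of the adjacency matrix. -/
def adjRows {n : ℕ} (G : SimpleGraph (Fin n)) : List (List Prop) :=
  List.ofFn fun i => List.ofFn fun j => G.Adj i j

theorem classCount_eq (L : List Label) : classCount L = (L.map Prod.fst).toFinset.card := by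
  induction L with
  | nil => rfl
  | cons l L ih =>
    rw [classCount, List.map_cons, List.toFinset_cons]
    split_ifs with h
    · rw [Finset.insert_eq_of_mem (List.mem_toFinset.2 h), ih]
    · rw [Finset.card_insert_of_notMem (fun h' => h (List.mem_toFinset.1 h')), ih]

theorem conflicts_eq {α : Type*} (c : Data) (adj : α → Prop) (lab : α → Label) (xs : List α) :
    conflicts c (xs.map adj) (xs.map lab) =
      (xs.filter fun x => adj x ∧ (lab x).1 ≠ c).map lab := by
  induction xs with
  | nil => rfl
  | cons x xs ih =>
    rw [List.map_cons, List.map_cons, conflicts, ih, List.filter_cons]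
    split_ifs <;> simp_all

theorem violation_eq_none {n : ℕ} {G : SimpleGraph (Fin n)} {lab : Fin n → Label}
    (h : violation (List.ofFn lab) (List.ofFn lab) (adjRows G) = none) :
    IsCutColoring G fun v => (lab v).1 := by
  have key : ∀ vs : List (Fin n), violation (List.ofFn lab) (vs.map lab)
      (vs.map fun i => List.ofFn fun j => G.Adj i j) = none → ∀ v ∈ vs, ∀ x y, G.Adj v x →
      G.Adj v y → (lab x).1 ≠ (lab v).1 → (lab y).1 ≠ (lab v).1 → x = y := by
    intro vs
    induction vs with
    | nil => simp
    | cons w vs ih =>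
      intro h
      rw [List.map_cons, List.map_cons, violation, List.ofFn_eq_map, List.ofFn_eq_map,
        conflicts_eq] at h
      simp only [← List.ofFn_eq_map] at h
      generalize hF : (List.finRange n).filter
        (fun x => decide (G.Adj w x ∧ (lab x).1 ≠ (lab w).1)) = F at h
      have hmem : ∀ x, G.Adj w x → (lab x).1 ≠ (lab w).1 → x ∈ F := by
        intro x hx hxw
        rw [← hF]
        simp [hx, hxw]
      have hrest : (∀ x y, x ∈ F → y ∈ F → x = y) ∧ violation (List.ofFn lab) (vs.map lab)
          (vs.map fun i => List.ofFn fun j => G.Adj i j) = none := by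
        match F, h with
        | [], h => exact ⟨by simp, h⟩
        | [_], h => exact ⟨by simp, h⟩
      intro v hv x y hx hy hxv hyv
      rcases List.mem_cons.1 hv with rfl | hv
      · exact hrest.1 x y (hmem x hx hxv) (hmem y hy hyv)
      · exact ih hrest.2 v hv x y hx hy hxv hyv
  intro v
  refine key (List.finRange n) ?_ v (List.mem_finRange v)
  rw [← List.ofFn_eq_map, ← List.ofFn_eq_map]
  exact h

theorem violation_eq_some {n : ℕ} {G : SimpleGraph (Fin n)} {lab : Fin n → Label}
    {a b c : Label}
    (h : violation (List.ofFn lab) (List.ofFn lab) (adjRows G) = some (a, b, c)) :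
    ∃ v x y, G.Adj v x ∧ G.Adj v y ∧ x ≠ y ∧ (lab x).1 ≠ (lab v).1 ∧ (lab y).1 ≠ (lab v).1 ∧
      a = lab v ∧ b = lab x ∧ c = lab y := by
  have key : ∀ vs : List (Fin n), violation (List.ofFn lab) (vs.map lab)
      (vs.map fun i => List.ofFn fun j => G.Adj i j) = some (a, b, c) → ∃ v x y, G.Adj v x ∧
      G.Adj v y ∧ x ≠ y ∧ (lab x).1 ≠ (lab v).1 ∧ (lab y).1 ≠ (lab v).1 ∧
      a = lab v ∧ b = lab x ∧ c = lab y := by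
    intro vs
    induction vs with
    | nil => simp [violation]
    | cons w vs ih =>
      intro h
      rw [List.map_cons, List.map_cons, violation, List.ofFn_eq_map, List.ofFn_eq_map,
        conflicts_eq] at h
      simp only [← List.ofFn_eq_map] at h
      generalize hF : (List.finRange n).filter
        (fun x => decide (G.Adj w x ∧ (lab x).1 ≠ (lab w).1)) = F at h
      have hnd : F.Nodup := hF ▸ (List.nodup_finRange n).filter _
      have hmem : ∀ x ∈ F, G.Adj w x ∧ (lab x).1 ≠ (lab w).1 := by
        intro x hx
        rw [← hF] at hx
        simpa using hx
      match F, h with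
      | [], h => exact ih h
      | [_], h => exact ih h
      | x :: y :: F, h =>
        simp only [List.map_cons, Option.some.injEq, Prod.mk.injEq] at h
        have hx := hmem x (by simp)
        have hy := hmem y (by simp)
        exact ⟨w, x, y, hx.1, hy.1, by rintro rfl; simp at hnd, hx.2, hy.2,
          h.1.symm, h.2.1.symm, h.2.2.symm⟩
  refine key (List.finRange n) ?_
  rw [← List.ofFn_eq_map, ← List.ofFn_eq_map]
  exact h

theorem relabel_ofFn {n : ℕ} (s t : Label) (lab : Fin n → Label) :
    relabel s t (List.ofFn lab) = List.ofFn fun z => if lab z = s then t else lab z := by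
  rw [relabel, List.map_ofFn]
  rfl

theorem exists_merge_eq_ofFn {n : ℕ} (v x : Label) (lab : Fin n → Label) :
    ∃ lab' : Fin n → Label, merge v x (List.ofFn lab) = List.ofFn lab' := by
  unfold merge
  split_ifs
  · exact ⟨_, relabel_ofFn _ _ _⟩
  · exact ⟨_, relabel_ofFn _ _ _⟩

theorem classCount_ofFn {n : ℕ} (lab : Fin n → Label) :
    classCount (List.ofFn lab) = (Set.range fun v => (lab v).1).ncard := by
  rw [classCount_eq, ← Set.ncard_coe_finset]
  congr 1
  ext c
  simp [List.mem_ofFn]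

theorem hasMatchingMulticut_of_accepts {n : ℕ} {G : SimpleGraph (Fin n)} {ℓ f : ℕ}
    {lab : Fin n → Label} (h : Accepts (adjRows G) ℓ f (List.ofFn lab)) :
    HasMatchingMulticut G ℓ := by
  induction f generalizing lab with
  | zero =>
    exact (violation_eq_none h.1).hasMatchingMulticut (h.2.trans_eq (classCount_ofFn lab))
  | succ f ih =>
    rw [Accepts] at h
    split at h
    · rename_i hv
      exact (violation_eq_none hv).hasMatchingMulticut (h.trans_eq (classCount_ofFn lab))
    · rename_i v x y hv
      rcases h with h | h
      · obtain ⟨lab', hl⟩ := exists_merge_eq_ofFn v x lab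
        exact ih (hl ▸ h)
      · obtain ⟨lab', hl⟩ := exists_merge_eq_ofFn v y lab
        exact ih (hl ▸ h)

theorem hasMatchingMulticut_of_acceptsSeeded {n : ℕ} {G : SimpleGraph (Fin n)} {ℓ f k : ℕ}
    {S : List Label} {lab : Fin n → Label}
    (h : AcceptsSeeded (adjRows G) ℓ f k S (List.ofFn lab)) : HasMatchingMulticut G ℓ := by
  induction S generalizing k lab with
  | nil =>
    cases k with
    | zero => exact hasMatchingMulticut_of_accepts h
    | succ k => exact h.elim
  | cons s S ih =>
    cases k with
    | zero => exact hasMatchingMulticut_of_accepts h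
    | succ k =>
      rcases h with h | h
      · rw [relabel_ofFn] at h
        exact ih h
      · exact ih h

/-- The labelling `lab` can be completed to the solution `p` by mergings. The colour `r` is the one
whose vertices stay free; every other colour already has a vertex that is not free. -/
structure Compatible {V β : Type*} (lab : V → Label) (p : V → β) (r : β) : Prop where
  color_eq : ∀ x y, lab x = lab y → p x = p y
  label_eq : ∀ x y, (lab x).1 = (lab y).1 → (lab x).1 ≠ .nil → lab x = lab y
  rest : ∀ x, (lab x).1 ≠ .nil → p x ≠ r
  seed : ∀ x, p x ≠ r → ∃ y, (lab y).1 ≠ .nil ∧ p y = p x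

/-- The labels of the vertices that are not free or have to leave the free class. Every merging
within a part of `p` removes one of them, so their number bounds the number of mergings. -/
noncomputable def pending {V β : Type*} [Fintype V] (lab : V → Label) (p : V → β) (r : β) :
    Finset Label :=
  (Finset.univ.filter fun z => (lab z).1 ≠ .nil ∨ p z ≠ r).image lab

theorem card_pending_le {V β : Type*} [Fintype V] {lab : V → Label} {p : V → β} {r : β}
    {s : Finset V} (h : ∀ z, (lab z).1 ≠ .nil ∨ p z ≠ r → z ∈ s) :
    (pending lab p r).card ≤ s.card :=
  Finset.card_image_le.trans (Finset.card_le_card fun z hz => h z (Finset.mem_filter.1 hz).2)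

section Merge

variable {V β : Type*} {lab : V → Label} {p : V → β} {r : β} {s t : V}

theorem Compatible.relabel (h : Compatible lab p r) (ht : (lab t).1 ≠ .nil) (hp : p s = p t) :
    Compatible (fun z => if lab z = lab s then lab t else lab z) p r where
  color_eq x y hxy := by
    split_ifs at hxy with hx hy hy
    · exact (h.color_eq _ _ hx).trans (h.color_eq _ _ hy).symm
    · rw [h.color_eq _ _ hx, hp, h.color_eq _ _ hxy]
    · rw [h.color_eq _ _ hxy, ← hp, h.color_eq _ _ hy]
    · exact h.color_eq _ _ hxy
  label_eq x y hxy hx0 := by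
    split_ifs at hxy hx0 ⊢ with hx hy hy
    · rfl
    · exact h.label_eq _ _ hxy hx0
    · exact h.label_eq _ _ hxy hx0
    · exact h.label_eq _ _ hxy hx0
  rest x hx := by
    split_ifs at hx with hxs
    · rw [h.color_eq _ _ hxs, hp]
      exact h.rest t hx
    · exact h.rest x hx
  seed x hx := by
    obtain ⟨y, hy, hyx⟩ := h.seed x hx
    refine ⟨y, ?_, hyx⟩
    split_ifs
    exacts [ht, hy]

theorem Compatible.card_pending_relabel_lt [Fintype V] (h : Compatible lab p r)
    (ht : (lab t).1 ≠ .nil) (hst : (lab s).1 ≠ (lab t).1) (hp : p s = p t) :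
    (pending (fun z => if lab z = lab s then lab t else lab z) p r).card <
      (pending lab p r).card := by
  have hs : lab s ∈ pending lab p r := by
    refine Finset.mem_image_of_mem _ (Finset.mem_filter.2 ⟨Finset.mem_univ _, Or.inr ?_⟩)
    rw [hp]
    exact h.rest t ht
  refine lt_of_le_of_lt (Finset.card_le_card (t := (pending lab p r).erase (lab s)) ?_)
    (Finset.card_erase_lt_of_mem hs)
  intro l hl
  obtain ⟨z, hz, rfl⟩ := Finset.mem_image.1 hl
  have hz := (Finset.mem_filter.1 hz).2
  rw [Finset.mem_erase]
  dsimp only at hz ⊢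
  split_ifs at hz ⊢ with hzs
  · exact ⟨fun e => hst (congrArg Prod.fst e).symm,
      Finset.mem_image_of_mem _ (Finset.mem_filter.2 ⟨Finset.mem_univ _, Or.inl ht⟩)⟩
  · exact ⟨hzs, Finset.mem_image_of_mem _ (Finset.mem_filter.2 ⟨Finset.mem_univ _, hz⟩)⟩

/-- A compatible labelling has at least as many classes as the solution has parts. -/
theorem Compatible.ncard_range_le [Finite V] (h : Compatible lab p r) :
    (Set.range p).ncard ≤ (Set.range fun v => (lab v).1).ncard := by
  have hrep : ∀ i : Set.range p, ∃ y, p y = i ∧ ((i : β) ≠ r → (lab y).1 ≠ .nil) := by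
    rintro ⟨i, x, rfl⟩
    by_cases hx : p x = r
    · exact ⟨x, rfl, fun hne => (hne hx).elim⟩
    · obtain ⟨y, hy, hyx⟩ := h.seed x hx
      exact ⟨y, hyx, fun _ => hy⟩
  choose g hg hg' using hrep
  rw [← Nat.card_coe_set_eq, ← Nat.card_coe_set_eq]
  refine Nat.card_le_card_of_injective
    (fun i => (⟨(lab (g i)).1, g i, rfl⟩ : Set.range fun v => (lab v).1)) ?_
  intro i j hij
  have hij : (lab (g i)).1 = (lab (g j)).1 := congrArg Subtype.val hij
  apply Subtype.ext
  by_cases h0 : (lab (g i)).1 = .nil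
  · have hi : (i : β) = r := by_contra fun hne => hg' i hne h0
    have hj : (j : β) = r := by_contra fun hne => hg' j hne (hij ▸ h0)
    rw [hi, hj]
  · rw [← hg i, ← hg j]
    exact h.color_eq _ _ (h.label_eq _ _ hij h0)

end Merge

/-- The search succeeds on a labelling compatible with a solution if the number of mergings allowed
is at least the number of pending labels. -/
theorem accepts_of_compatible {n : ℕ} {G : SimpleGraph (Fin n)} {ℓ f : ℕ} {β : Type*}
    {lab : Fin n → Label} {p : Fin n → β} {r : β} (hG : IsCutColoring G p)
    (hℓ : ℓ ≤ (Set.range p).ncard) (h : Compatible lab p r) (hf : (pending lab p r).card ≤ f) :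
    Accepts (adjRows G) ℓ f (List.ofFn lab) := by
  induction f generalizing lab with
  | zero =>
    refine ⟨?_, (classCount_ofFn lab).symm ▸ hℓ.trans h.ncard_range_le⟩
    rcases hv : violation (List.ofFn lab) (List.ofFn lab) (adjRows G) with _ | ⟨a, b, c⟩
    · rfl
    · obtain ⟨v, x, y, -, -, -, hxv, -, -⟩ := violation_eq_some hv
      have hmem : ∀ z, (lab z).1 ≠ .nil → False := fun z hz => by
        have : lab z ∈ pending lab p r :=
          Finset.mem_image_of_mem _ (Finset.mem_filter.2 ⟨Finset.mem_univ _, Or.inl hz⟩)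
        rw [Finset.card_eq_zero.1 (Nat.le_zero.1 hf)] at this
        simp at this
      by_cases h0 : (lab v).1 = .nil
      · exact (hmem x (h0 ▸ hxv)).elim
      · exact (hmem v h0).elim
  | succ f ih =>
    rw [Accepts]
    rcases hv : violation (List.ofFn lab) (List.ofFn lab) (adjRows G) with _ | ⟨a, b, c⟩
    · exact (classCount_ofFn lab).symm ▸ hℓ.trans h.ncard_range_le
    · obtain ⟨v, x, y, hvx, hvy, hxy, hxv, hyv, rfl, rfl, rfl⟩ := violation_eq_some hv
      have key : ∀ z, (lab z).1 ≠ (lab v).1 → p z = p v →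
          Accepts (adjRows G) ℓ f (merge (lab v) (lab z) (List.ofFn lab)) := by
        intro z hzv hpz
        unfold merge
        split_ifs with h0
        · have hz : (lab z).1 ≠ .nil := h0 ▸ hzv
          rw [relabel_ofFn]
          exact ih (h.relabel hz hpz.symm) (Nat.le_of_lt_succ
            ((h.card_pending_relabel_lt hz hzv.symm hpz.symm).trans_le hf))
        · rw [relabel_ofFn]
          exact ih (h.relabel h0 hpz) (Nat.le_of_lt_succ
            ((h.card_pending_relabel_lt h0 hzv hpz).trans_le hf))
      by_cases hpx : p x = p v
      · exact Or.inl (key x hxv hpx)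
      · by_cases hpy : p y = p v
        · exact Or.inr (key y hyv hpy)
        · exact (hxy (hG v x y hvx hvy hpx hpy)).elim

theorem acceptsSeeded_of_sublist {rows : List (List Prop)} {ℓ f : ℕ} {T S L : List Label}
    (hT : T.Sublist S) (hT' : ∀ l ∈ T, l.1 = .nil ∧ l.2 ≠ .nil)
    (h : Accepts rows ℓ f (L.map fun l => if l ∈ T then (l.2, l.2) else l)) :
    AcceptsSeeded rows ℓ f T.length S L := by
  induction hT generalizing L with
  | slnil => simpa [AcceptsSeeded] using h
  | @cons T S s hTS ih =>
    have := ih hT' h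
    cases T with
    | nil => simpa [AcceptsSeeded] using this
    | cons t T => exact Or.inr this
  | @cons_cons T S s hTS ih =>
    refine Or.inl (ih (fun l hl => hT' l (List.mem_cons_of_mem _ hl)) ?_)
    have hs := hT' s List.mem_cons_self
    convert h using 1
    rw [relabel, List.map_map]
    refine List.map_congr_left fun l _ => ?_
    simp only [Function.comp_apply, List.mem_cons]
    by_cases hls : l = s
    · subst hls
      have : (l.2, l.2) ∉ T := fun hl =>
        hs.2 (hT' _ (List.mem_cons_of_mem _ hl)).1
      simp [this]
    · simp [hls]

end Algorithm

/-! ### The program -/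

section Code

/-- The truth value `true`. -/
def Expr.tt : Expr := .cons .nil .nil

/-! The indices of the functions of the program. -/

abbrev eqFn : ℕ := 0
abbrev conflictsFn : ℕ := 1
abbrev violationFn : ℕ := 2
abbrev relabelFn : ℕ := 3
abbrev mergeFn : ℕ := 4
abbrev memFn : ℕ := 5
abbrev classCountFn : ℕ := 6
abbrev halfFn : ℕ := 7
abbrev twoThirdsFn : ℕ := 8
abbrev geFn : ℕ := 9
abbrev acceptsFn : ℕ := 10
abbrev seededFn : ℕ := 11
abbrev freeLabelsFn : ℕ := 12
abbrev fullLabelsFn : ℕ := 13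

/-- Equality of two trees; the argument is `(a, b)`. -/
def eqCode : Expr :=
  .caseOf (.var 0) .nil <|
  .caseOf (.var 0) (.caseOf (.var 1) .tt .nil) <|
  .caseOf (.var 3) .nil <|
  .caseOf (.call eqFn (.cons (.var 2) (.var 0))) .nil <|
  .call eqFn (.cons (.var 5) (.var 3))

/-- `conflicts`; the argument is `(c, row, L)`. -/
def conflictsCode : Expr :=
  .caseOf (.var 0) .nil <|
  .caseOf (.var 1) .nil <|
  .caseOf (.var 0) .nil <|
  .caseOf (.var 3) .nil <|
  .letIn (.call conflictsFn (.cons (.var 6) (.cons (.var 3) (.var 1)))) <|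
  .caseOf (.var 3) (.var 0) <|
  .caseOf (.var 3) .nil <|
  .caseOf (.call eqFn (.cons (.var 0) (.var 11))) (.cons (.var 5) (.var 4)) (.var 6)

/-- `violation`; the argument is `(vs, rows, L)`. -/
def violationCode : Expr :=
  .caseOf (.var 0) .nil <|
  .caseOf (.var 1) .nil <|
  .caseOf (.var 0) .nil <|
  .caseOf (.var 4) .nil <|
  .caseOf (.var 0) .nil <|
  .letIn (.call violationFn (.cons (.var 3) (.cons (.var 5) (.var 7)))) <|
  .caseOf (.call conflictsFn (.cons (.var 1) (.cons (.var 5) (.var 8)))) (.var 0) <|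
  .caseOf (.var 1) (.var 2) <|
  .cons (.var 7) (.cons (.var 2) (.var 0))

/-- `relabel`; the argument is `((s, t), L)`. -/
def relabelCode : Expr :=
  .caseOf (.var 0) .nil <|
  .caseOf (.var 1) .nil <|
  .letIn (.call relabelFn (.cons (.var 2) (.var 1))) <|
  .caseOf (.var 3) .nil <|
  .caseOf (.call eqFn (.cons (.var 3) (.var 0)))
    (.cons (.var 3) (.var 2)) (.cons (.var 3) (.var 4))

/-- `merge`; the argument is `((v, x), L)`. -/
def mergeCode : Expr :=
  .caseOf (.var 0) .nil <|
  .caseOf (.var 0) .nil <|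
  .caseOf (.var 0) .nil <|
  .caseOf (.var 0) (.call relabelFn (.cons (.var 4) (.var 5))) <|
  .call relabelFn (.cons (.cons (.var 5) (.var 4)) (.var 7))

/-- Whether `c` is the class of a label in `L`; the argument is `(c, L)`. -/
def memCode : Expr :=
  .caseOf (.var 0) .nil <|
  .caseOf (.var 1) .nil <|
  .caseOf (.var 0) .nil <|
  .caseOf (.call eqFn (.cons (.var 0) (.var 4))) (.call memFn (.cons (.var 4) (.var 3))) .tt

/-- `classCount` in unary; the argument is `L`. -/
def classCountCode : Expr :=
  .caseOf (.var 0) .nil <|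
  .caseOf (.var 0) .nil <|
  .letIn (.call classCountFn (.var 3)) <|
  .caseOf (.call memFn (.cons (.var 1) (.var 4))) (.cons .nil (.var 0)) (.var 2)

/-- Half the length of a list, rounded down, in unary. -/
def halfCode : Expr :=
  .caseOf (.var 0) .nil <|
  .caseOf (.var 1) .nil <|
  .cons .nil (.call halfFn (.var 1))

/-- Two thirds of the length of a list, rounded down, in unary. -/
def twoThirdsCode : Expr :=
  .caseOf (.var 0) .nil <|
  .caseOf (.var 1) .nil <|
  .cons .nil <|
  .caseOf (.var 1) .nil <|
  .cons .nil (.call twoThirdsFn (.var 1))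

/-- Whether the length of the list `u` is at least the number with binary digits `bits`; the
argument is `(u, bits)`. Both are halved in each round. When `u` is exhausted, the remaining digits
need not be read, as the most significant one is `1`; thus the time depends on `u` only. -/
def geCode : Expr :=
  .caseOf (.var 0) .nil <|
  .caseOf (.var 1) .tt <|
  .caseOf (.var 2) .nil <|
  .call geFn (.cons (.call halfFn (.caseOf (.var 2) (.var 4) (.var 3))) (.var 3))

/-- `Accepts`; the argument is `(f, L, rows, bits)`. -/
def acceptsCode : Expr :=
  .caseOf (.var 0) .nil <|
  .caseOf (.var 1) .nil <|
  .caseOf (.var 1) .nil <|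
  .caseOf (.call violationFn (.cons (.var 2) (.cons (.var 0) (.var 2))))
    (.call geFn (.cons (.call classCountFn (.var 2)) (.var 1))) <|
  .caseOf (.var 6) .nil <|
  .caseOf (.var 3) .nil <|
  .caseOf (.call acceptsFn (.cons (.var 3) (.cons
      (.call mergeFn (.cons (.cons (.var 4) (.var 0)) (.var 8))) (.cons (.var 6) (.var 7)))))
    (.call acceptsFn (.cons (.var 3) (.cons
      (.call mergeFn (.cons (.cons (.var 4) (.var 1)) (.var 8))) (.cons (.var 6) (.var 7)))))
    .tt

/-- `AcceptsSeeded`; the argument is `(k, S, L, f, rows, bits)`. -/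
def seededCode : Expr :=
  .caseOf (.var 0) .nil <|
  .caseOf (.var 1) .nil <|
  .caseOf (.var 1) .nil <|
  .caseOf (.var 4)
    (.caseOf (.var 1) .nil (.call acceptsFn (.cons (.var 0) (.cons (.var 2) (.var 1))))) <|
  .caseOf (.var 4) .nil <|
  .caseOf (.var 0) .nil <|
  .caseOf (.call seededFn (.cons (.var 5) (.cons (.var 3) (.cons
      (.call relabelFn (.cons (.cons (.var 2) (.cons (.var 1) (.var 1))) (.var 6))) (.var 7)))))
    (.call seededFn (.cons (.var 10) (.cons (.var 3) (.cons (.var 6) (.var 7)))))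
    .tt

/-- Labels that make all vertices free; the argument is the list of rows. -/
def freeLabelsCode : Expr :=
  .caseOf (.var 0) .nil <|
  .cons (.cons .nil (.var 2)) (.call freeLabelsFn (.var 1))

/-- Labels that make every vertex a class; the argument is the list of rows. -/
def fullLabelsCode : Expr :=
  .caseOf (.var 0) .nil <|
  .cons (.cons (.var 2) (.var 2)) (.call fullLabelsFn (.var 1))

/-- The bodies of the functions of the program. -/
def codes : List Expr :=
  [eqCode, conflictsCode, violationCode, relabelCode, mergeCode, memCode, classCountCode,
    halfCode, twoThirdsCode, geCode, acceptsCode, seededCode, freeLabelsCode, fullLabelsCode]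

/-- The main expression, on the input `(rows, bits)`. Up to three parts are sought from one seed
per part except the largest, four or more parts from the partition into single vertices. -/
def mainCode : Expr :=
  .caseOf (.var 0) .nil <|
  .letIn (.call freeLabelsFn (.var 0)) <|
  .caseOf (.var 2) .nil <|
  .caseOf (.var 1)
    (.call seededFn (.cons .nil (.cons (.var 2) (.cons (.var 2)
      (.cons .nil (.cons (.var 3) (.var 4))))))) <|
  .caseOf (.var 1)
    (.caseOf (.var 2)
      (.call seededFn (.cons .tt (.cons (.var 4) (.cons (.var 4)
        (.cons (.call halfFn (.var 5)) (.cons (.var 5) (.var 6))))))) <|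
      .call seededFn (.cons (.cons .nil .tt) (.cons (.var 6) (.cons (.var 6)
        (.cons (.call twoThirdsFn (.var 7)) (.cons (.var 7) (.var 8))))))) <|
  .call acceptsFn (.cons (.var 7) (.cons (.call fullLabelsFn (.var 7))
    (.cons (.var 7) (.var 8))))

/-- The program that decides Matching Multicut. -/
def multicutProgram : Program where
  functions := codes
  main := mainCode

end Code

/-! ### Correctness and running time of the functions -/

section Semantics

open scoped Classical

/-- The program evaluates `e` to `v` in at most `B` steps. -/
def EvalsIn (env : List Data) (e : Expr) (v : Data) (B : ℕ) : Prop :=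
  ∃ t ≤ B, Eval codes env e v t

/-- The number of nodes of a tree. -/
def Data.size : Data → ℕ
  | .nil => 1
  | .cons a b => a.size + b.size + 1

/-- A label as data. -/
def encodeLabel (l : Label) : Data := .cons l.1 l.2

/-- A list of labels as data. -/
def encodeLabels (L : List Label) : Data := encodeList (L.map encodeLabel)

/-- A row of the adjacency matrix as data. -/
noncomputable def encodeRow (row : List Prop) : Data := encodeList (row.map encodeProp)

/-- The adjacency matrix as data. -/
noncomputable def encodeRows (rows : List (List Prop)) : Data := encodeList (rows.map encodeRow)

theorem encodeProp_pos {p : Prop} (h : p) : encodeProp p = .cons .nil .nil := if_pos h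

theorem encodeProp_neg {p : Prop} (h : ¬ p) : encodeProp p = .nil := if_neg h

theorem Eval.tt (env : List Data) : Eval codes env .tt (.cons .nil .nil) 3 := .cons .nil .nil

theorem evalsIn_eq (a b : Data) :
    EvalsIn [.cons a b] eqCode (encodeProp (a = b)) (20 * a.size) := by
  induction a generalizing b with
  | nil =>
    cases b with
    | nil =>
      rw [encodeProp_pos rfl]
      exact ⟨_, by simp [Data.size],
        .caseCons (.var rfl) (.caseNil (.var rfl) (.caseNil (.var rfl) (.tt _)))⟩
    | cons b₁ b₂ =>
      rw [encodeProp_neg (by simp)]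
      exact ⟨_, by simp [Data.size],
        .caseCons (.var rfl) (.caseNil (.var rfl) (.caseCons (.var rfl) .nil))⟩
  | cons a₁ a₂ ih₁ ih₂ =>
    cases b with
    | nil =>
      rw [encodeProp_neg (by simp)]
      exact ⟨_, by simp only [Data.size]; omega,
        .caseCons (.var rfl) (.caseCons (.var rfl) (.caseNil (.var rfl) .nil))⟩
    | cons b₁ b₂ =>
      obtain ⟨t₁, ht₁, h₁⟩ := ih₁ b₁
      obtain ⟨t₂, ht₂, h₂⟩ := ih₂ b₂
      by_cases h : a₁ = b₁
      · rw [encodeProp_pos h] at h₁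
        have he : encodeProp (Data.cons a₁ a₂ = .cons b₁ b₂) = encodeProp (a₂ = b₂) := by
          simp [h]
        rw [he]
        exact ⟨_, by simp only [Data.size]; omega,
          .caseCons (.var rfl) (.caseCons (.var rfl) (.caseCons (.var rfl)
            (.caseCons (.call rfl (.cons (.var rfl) (.var rfl)) h₁)
              (.call rfl (.cons (.var rfl) (.var rfl)) h₂))))⟩
      · rw [encodeProp_neg h] at h₁
        rw [encodeProp_neg (by simp [h])]
        exact ⟨_, by simp only [Data.size]; omega,
          .caseCons (.var rfl) (.caseCons (.var rfl) (.caseCons (.var rfl)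
            (.caseNil (.call rfl (.cons (.var rfl) (.var rfl)) h₁) .nil)))⟩

theorem size_class_lt (l : Label) : l.1.size < (encodeLabel l).size := by
  simp only [encodeLabel, Data.size]
  omega

variable {M : ℕ}

theorem evalsIn_conflicts (c : Data) (row : List Prop) (L : List Label)
    (hM : ∀ l ∈ L, (encodeLabel l).size ≤ M) :
    EvalsIn [.cons c (.cons (encodeRow row) (encodeLabels L))] conflictsCode
      (encodeLabels (conflicts c row L)) ((20 * M + 50) * (row.length + 1)) := by
  induction row generalizing L with
  | nil =>
    have : conflicts c [] L = [] := by simp [conflicts]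
    rw [this]
    exact ⟨_, by simp,
      .caseCons (.var rfl) (.caseCons (.var rfl) (.caseNil (.var rfl) .nil))⟩
  | cons b row ih =>
    have hB : (20 * M + 50) * ((b :: row).length + 1) =
      (20 * M + 50) * (row.length + 1) + (20 * M + 50) := by rw [List.length_cons]; ring
    rw [hB]
    cases L with
    | nil =>
      exact ⟨_, by omega, .caseCons (.var rfl) (.caseCons (.var rfl) (.caseCons (.var rfl)
        (.caseNil (.var rfl) .nil)))⟩
    | cons l L =>
      obtain ⟨t, ht, h⟩ := ih L fun l' hl' => hM l' (List.mem_cons_of_mem _ hl')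
      obtain ⟨t', ht', h'⟩ := evalsIn_eq l.1 c
      have hl := hM l List.mem_cons_self
      have hl' := size_class_lt l
      by_cases hb : b
      · by_cases hc : l.1 = c
        · rw [encodeProp_pos hc] at h'
          rw [conflicts, if_neg (by simp [hc])]
          exact ⟨_, by omega, .caseCons (.var rfl) (.caseCons (.var rfl) (.caseCons (.var rfl)
            (.caseCons (.var rfl) (.letIn (.call rfl (.cons (.var rfl) (.cons (.var rfl)
              (.var rfl))) h) (.caseCons (.var (congrArg some (encodeProp_pos hb)))
                (.caseCons (.var rfl) (.caseCons (.call rfl (.cons (.var rfl) (.var rfl)) h')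
                  (.var rfl))))))))⟩
        · rw [encodeProp_neg hc] at h'
          rw [conflicts, if_pos ⟨hb, hc⟩]
          exact ⟨_, by omega, .caseCons (.var rfl) (.caseCons (.var rfl) (.caseCons (.var rfl)
            (.caseCons (.var rfl) (.letIn (.call rfl (.cons (.var rfl) (.cons (.var rfl)
              (.var rfl))) h) (.caseCons (.var (congrArg some (encodeProp_pos hb)))
                (.caseCons (.var rfl) (.caseNil (.call rfl (.cons (.var rfl) (.var rfl)) h')
                  (.cons (.var rfl) (.var rfl)))))))))⟩
      · rw [conflicts, if_neg (by simp [hb])]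
        exact ⟨_, by omega, .caseCons (.var rfl) (.caseCons (.var rfl) (.caseCons (.var rfl)
            (.caseCons (.var rfl) (.letIn (.call rfl (.cons (.var rfl) (.cons (.var rfl)
              (.var rfl))) h) (.caseNil (.var (congrArg some (encodeProp_neg hb)))
                (.var rfl))))))⟩

/-- The result of `violation` as data. -/
def encodeViolation : Option (Label × Label × Label) → Data
  | none => .nil
  | some (v, x, y) => .cons (encodeLabel v) (.cons (encodeLabel x) (encodeLabel y))

theorem evalsIn_violation {m : ℕ} (L vs : List Label) (rows : List (List Prop))
    (hM : ∀ l ∈ L, (encodeLabel l).size ≤ M) (hm : ∀ row ∈ rows, row.length ≤ m) :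
    EvalsIn [.cons (encodeLabels vs) (.cons (encodeRows rows) (encodeLabels L))] violationCode
      (encodeViolation (violation L vs rows))
      (((20 * M + 50) * (m + 1) + 50) * (rows.length + 1)) := by
  induction rows generalizing vs with
  | nil =>
    have : violation L vs [] = none := by simp [violation]
    rw [this]
    exact ⟨_, by simp,
      .caseCons (.var rfl) (.caseCons (.var rfl) (.caseNil (.var rfl) .nil))⟩
  | cons row rows ih =>
    generalize hK : (20 * M + 50) * (m + 1) = K at ih ⊢
    have hB : (K + 50) * ((row :: rows).length + 1) =
      (K + 50) * (rows.length + 1) + (K + 50) := by rw [List.length_cons]; ring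
    rw [hB]
    cases vs with
    | nil =>
      exact ⟨_, by omega, .caseCons (.var rfl) (.caseCons (.var rfl) (.caseCons (.var rfl)
        (.caseNil (.var rfl) .nil)))⟩
    | cons v vs =>
      obtain ⟨t, ht, h⟩ := ih vs fun r hr => hm r (List.mem_cons_of_mem _ hr)
      obtain ⟨t', ht', h'⟩ := evalsIn_conflicts v.1 row L hM
      replace ht' : t' ≤ K := ht'.trans (hK ▸ Nat.mul_le_mul_left _
        (Nat.succ_le_succ (hm row List.mem_cons_self)))
      rw [violation]
      match hc : conflicts v.1 row L with
      | [] =>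
        rw [hc] at h'
        exact ⟨_, by omega, .caseCons (.var rfl) (.caseCons (.var rfl) (.caseCons (.var rfl)
          (.caseCons (.var rfl) (.caseCons (.var rfl) (.letIn (.call rfl (.cons (.var rfl)
            (.cons (.var rfl) (.var rfl))) h) (.caseNil (.call rfl (.cons (.var rfl)
              (.cons (.var rfl) (.var rfl))) h') (.var rfl)))))))⟩
      | [x] =>
        rw [hc] at h'
        exact ⟨_, by omega, .caseCons (.var rfl) (.caseCons (.var rfl) (.caseCons (.var rfl)
          (.caseCons (.var rfl) (.caseCons (.var rfl) (.letIn (.call rfl (.cons (.var rfl)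
            (.cons (.var rfl) (.var rfl))) h) (.caseCons (.call rfl (.cons (.var rfl)
              (.cons (.var rfl) (.var rfl))) h') (.caseNil (.var rfl) (.var rfl))))))))⟩
      | x :: y :: r =>
        rw [hc] at h'
        exact ⟨_, by omega, .caseCons (.var rfl) (.caseCons (.var rfl) (.caseCons (.var rfl)
          (.caseCons (.var rfl) (.caseCons (.var rfl) (.letIn (.call rfl (.cons (.var rfl)
            (.cons (.var rfl) (.var rfl))) h) (.caseCons (.call rfl (.cons (.var rfl)
              (.cons (.var rfl) (.var rfl))) h') (.caseCons (.var rfl) (.cons (.var rfl)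
                (.cons (.var rfl) (.var rfl))))))))))⟩

theorem encodeLabel_injective : Function.Injective encodeLabel := by
  rintro ⟨a, b⟩ ⟨c, d⟩ h
  simpa [encodeLabel] using h

theorem evalsIn_relabel (s t : Label) (L : List Label)
    (hM : ∀ l ∈ L, (encodeLabel l).size ≤ M) :
    EvalsIn [.cons (.cons (encodeLabel s) (encodeLabel t)) (encodeLabels L)] relabelCode
      (encodeLabels (relabel s t L)) ((20 * M + 50) * (L.length + 1)) := by
  induction L with
  | nil => exact ⟨_, by simp, .caseCons (.var rfl) (.caseNil (.var rfl) .nil)⟩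
  | cons l L ih =>
    have hB : (20 * M + 50) * ((l :: L).length + 1) =
      (20 * M + 50) * (L.length + 1) + (20 * M + 50) := by rw [List.length_cons]; ring
    rw [hB]
    obtain ⟨t₁, ht₁, h₁⟩ := ih fun l' hl' => hM l' (List.mem_cons_of_mem _ hl')
    obtain ⟨t₂, ht₂, h₂⟩ := evalsIn_eq (encodeLabel l) (encodeLabel s)
    have hl := hM l List.mem_cons_self
    by_cases hs : l = s
    · have he : relabel s t (l :: L) = t :: relabel s t L := by simp [relabel, hs]
      rw [encodeProp_pos (congrArg _ hs)] at h₂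
      rw [he]
      exact ⟨_, by omega, .caseCons (.var rfl) (.caseCons (.var rfl) (.letIn
        (.call rfl (.cons (.var rfl) (.var rfl)) h₁) (.caseCons (.var rfl)
          (.caseCons (.call rfl (.cons (.var rfl) (.var rfl)) h₂)
            (.cons (.var rfl) (.var rfl))))))⟩
    · have he : relabel s t (l :: L) = l :: relabel s t L := by simp [relabel, hs]
      rw [encodeProp_neg fun h => hs (encodeLabel_injective h)] at h₂
      rw [he]
      exact ⟨_, by omega, .caseCons (.var rfl) (.caseCons (.var rfl) (.letIn
        (.call rfl (.cons (.var rfl) (.var rfl)) h₁) (.caseCons (.var rfl)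
          (.caseNil (.call rfl (.cons (.var rfl) (.var rfl)) h₂)
            (.cons (.var rfl) (.var rfl))))))⟩

theorem evalsIn_merge (v x : Label) (L : List Label)
    (hM : ∀ l ∈ L, (encodeLabel l).size ≤ M) :
    EvalsIn [.cons (.cons (encodeLabel v) (encodeLabel x)) (encodeLabels L)] mergeCode
      (encodeLabels (merge v x L)) ((20 * M + 50) * (L.length + 1) + 50) := by
  obtain ⟨c, i⟩ := v
  cases c with
  | nil =>
    obtain ⟨t, ht, h⟩ := evalsIn_relabel (.nil, i) x L hM
    rw [merge, if_pos rfl]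
    exact ⟨_, by omega, .caseCons (.var rfl) (.caseCons (.var rfl) (.caseCons (.var rfl)
      (.caseNil (.var rfl) (.call rfl (.cons (.var rfl) (.var rfl)) h))))⟩
  | cons c₁ c₂ =>
    obtain ⟨t, ht, h⟩ := evalsIn_relabel x (.cons c₁ c₂, i) L hM
    rw [merge, if_neg (by simp)]
    exact ⟨_, by omega, .caseCons (.var rfl) (.caseCons (.var rfl) (.caseCons (.var rfl)
      (.caseCons (.var rfl) (.call rfl (.cons (.cons (.var rfl) (.var rfl)) (.var rfl)) h))))⟩

theorem evalsIn_mem (c : Data) (L : List Label) (hM : ∀ l ∈ L, (encodeLabel l).size ≤ M) :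
    EvalsIn [.cons c (encodeLabels L)] memCode (encodeProp (c ∈ L.map Prod.fst))
      ((20 * M + 50) * (L.length + 1)) := by
  induction L with
  | nil =>
    rw [encodeProp_neg (by simp)]
    exact ⟨_, by simp, .caseCons (.var rfl) (.caseNil (.var rfl) .nil)⟩
  | cons l L ih =>
    have hB : (20 * M + 50) * ((l :: L).length + 1) =
      (20 * M + 50) * (L.length + 1) + (20 * M + 50) := by rw [List.length_cons]; ring
    rw [hB]
    obtain ⟨t₁, ht₁, h₁⟩ := ih fun l' hl' => hM l' (List.mem_cons_of_mem _ hl')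
    obtain ⟨t₂, ht₂, h₂⟩ := evalsIn_eq l.1 c
    have hl := hM l List.mem_cons_self
    have hl' := size_class_lt l
    by_cases hc : l.1 = c
    · rw [encodeProp_pos hc] at h₂
      rw [encodeProp_pos (by simp [hc])]
      exact ⟨_, by omega, .caseCons (.var rfl) (.caseCons (.var rfl) (.caseCons (.var rfl)
        (.caseCons (.call rfl (.cons (.var rfl) (.var rfl)) h₂) (.tt _))))⟩
    · rw [encodeProp_neg hc] at h₂
      have he : (c ∈ (l :: L).map Prod.fst) = (c ∈ L.map Prod.fst) := by
        rw [List.map_cons, List.mem_cons, eq_iff_iff, or_iff_right (Ne.symm hc)]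
      rw [he]
      exact ⟨_, by omega, .caseCons (.var rfl) (.caseCons (.var rfl) (.caseCons (.var rfl)
        (.caseNil (.call rfl (.cons (.var rfl) (.var rfl)) h₂)
          (.call rfl (.cons (.var rfl) (.var rfl)) h₁))))⟩

/-- A number in unary. -/
def encodeUnary (k : ℕ) : Data := encodeList (List.replicate k .nil)

theorem evalsIn_classCount {m : ℕ} (L : List Label) (hM : ∀ l ∈ L, (encodeLabel l).size ≤ M)
    (hm : L.length ≤ m) :
    EvalsIn [encodeLabels L] classCountCode (encodeUnary (classCount L))
      (((20 * M + 50) * (m + 1) + 50) * (L.length + 1)) := by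
  induction L with
  | nil => exact ⟨_, by simp, .caseNil (.var rfl) .nil⟩
  | cons l L ih =>
    obtain ⟨t₂, ht₂, h₂⟩ := evalsIn_mem l.1 L fun l' hl' => hM l' (List.mem_cons_of_mem _ hl')
    have hm' : L.length + 1 ≤ m := hm
    obtain ⟨t₁, ht₁, h₁⟩ := ih (fun l' hl' => hM l' (List.mem_cons_of_mem _ hl')) (by omega)
    replace ht₂ := ht₂.trans (Nat.mul_le_mul_left _ (show L.length + 1 ≤ m + 1 by omega))
    generalize (20 * M + 50) * (m + 1) = K at *
    have hB : (K + 50) * ((l :: L).length + 1) =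
      (K + 50) * (L.length + 1) + (K + 50) := by rw [List.length_cons]; ring
    rw [hB]
    by_cases hc : l.1 ∈ L.map Prod.fst
    · rw [encodeProp_pos hc] at h₂
      rw [classCount, if_pos hc]
      exact ⟨_, by omega, .caseCons (.var rfl) (.caseCons (.var rfl)
        (.letIn (.call rfl (.var rfl) h₁) (.caseCons (.call rfl (.cons (.var rfl) (.var rfl)) h₂)
          (.var rfl))))⟩
    · rw [encodeProp_neg hc] at h₂
      rw [classCount, if_neg hc]
      exact ⟨_, by omega, .caseCons (.var rfl) (.caseCons (.var rfl)
        (.letIn (.call rfl (.var rfl) h₁) (.caseNil (.call rfl (.cons (.var rfl) (.var rfl)) h₂)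
          (.cons .nil (.var rfl)))))⟩

theorem evalsIn_half : ∀ u : List Data,
    EvalsIn [encodeList u] halfCode (encodeUnary (u.length / 2)) (10 * (u.length + 1))
  | [] => ⟨_, by simp, .caseNil (.var rfl) .nil⟩
  | [a] => by
    have he : [a].length / 2 = 0 := by simp
    rw [he]
    exact ⟨_, by simp, .caseCons (.var rfl) (.caseNil (.var rfl) .nil)⟩
  | a :: b :: u => by
    obtain ⟨t, ht, h⟩ := evalsIn_half u
    have he : (a :: b :: u).length / 2 = u.length / 2 + 1 := by
      simp only [List.length_cons]; omega
    rw [he]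
    exact ⟨_, by simp only [List.length_cons]; omega, .caseCons (.var rfl) (.caseCons (.var rfl)
      (.cons .nil (.call rfl (.var rfl) h)))⟩

theorem evalsIn_twoThirds : ∀ u : List Data,
    EvalsIn [encodeList u] twoThirdsCode (encodeUnary (2 * u.length / 3)) (20 * (u.length + 1))
  | [] => ⟨_, by simp, .caseNil (.var rfl) .nil⟩
  | [a] => by
    have he : 2 * [a].length / 3 = 0 := by simp
    rw [he]
    exact ⟨_, by simp, .caseCons (.var rfl) (.caseNil (.var rfl) .nil)⟩
  | [a, b] => by
    have he : 2 * [a, b].length / 3 = 1 := by simp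
    rw [he]
    exact ⟨_, by simp, .caseCons (.var rfl) (.caseCons (.var rfl)
      (.cons .nil (.caseNil (.var rfl) .nil)))⟩
  | a :: b :: c :: u => by
    obtain ⟨t, ht, h⟩ := evalsIn_twoThirds u
    have he : 2 * (a :: b :: c :: u).length / 3 = 2 * u.length / 3 + 1 + 1 := by
      simp only [List.length_cons]; omega
    rw [he]
    exact ⟨_, by simp only [List.length_cons]; omega, .caseCons (.var rfl) (.caseCons (.var rfl)
      (.cons .nil (.caseCons (.var rfl) (.cons .nil (.call rfl (.var rfl) h)))))⟩

theorem encodeNat_zero : encodeNat 0 = .nil := by simp [encodeNat, encodeList]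

theorem encodeNat_bit (b : Bool) (m : ℕ) (h : m = 0 → b = true) :
    encodeNat (Nat.bit b m) = .cons (encodeProp (b = true)) (encodeNat m) := by
  simp [encodeNat, Nat.bits_append_bit _ _ h, encodeList]

theorem evalsIn_ge (m : ℕ) (u : List Data) :
    EvalsIn [.cons (encodeList u) (encodeNat m)] geCode (encodeProp (m ≤ u.length))
      (60 * (u.length + 1)) := by
  induction m using Nat.binaryRec' generalizing u with
  | zero =>
    rw [encodeNat_zero, encodeProp_pos (Nat.zero_le _)]
    exact ⟨_, by omega, .caseCons (.var rfl) (.caseNil (.var rfl) (.tt _))⟩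
  | bit b m hm ih =>
    rw [encodeNat_bit b m hm]
    cases u with
    | nil =>
      have : ¬ Nat.bit b m ≤ ([] : List Data).length := by
        cases b <;> simp [Nat.bit] at hm ⊢
        exact hm
      rw [encodeProp_neg this]
      exact ⟨_, by simp, .caseCons (.var rfl) (.caseCons (.var rfl) (.caseNil (.var rfl) .nil))⟩
    | cons a u =>
      -- the last digit of the number decides whether one element is dropped before halving
      cases b with
      | false =>
        obtain ⟨t₁, ht₁, h₁⟩ := evalsIn_half (a :: u)
        obtain ⟨t₂, ht₂, h₂⟩ := ih (List.replicate ((a :: u).length / 2) .nil)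
        simp only [List.length_replicate, List.length_cons] at ht₁ ht₂ h₁ h₂
        have he : (Nat.bit false m ≤ (a :: u).length) = (m ≤ (u.length + 1) / 2) := by
          simp [Nat.bit]; omega
        rw [he]
        exact ⟨_, by simp only [List.length_cons]; omega, .caseCons (.var rfl)
          (.caseCons (.var rfl) (.caseCons (.var rfl) (.call rfl (.cons (.call rfl
            (.caseNil (.var (congrArg some (encodeProp_neg (by simp)))) (.var rfl)) h₁)
              (.var rfl)) h₂)))⟩
      | true =>
        obtain ⟨t₁, ht₁, h₁⟩ := evalsIn_half u
        obtain ⟨t₂, ht₂, h₂⟩ := ih (List.replicate (u.length / 2) .nil)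
        simp only [List.length_replicate] at ht₂ h₂
        have he : (Nat.bit true m ≤ (a :: u).length) = (m ≤ u.length / 2) := by
          simp [Nat.bit]; omega
        rw [he]
        exact ⟨_, by simp only [List.length_cons]; omega, .caseCons (.var rfl)
          (.caseCons (.var rfl) (.caseCons (.var rfl) (.call rfl (.cons (.call rfl
            (.caseCons (.var (congrArg some (encodeProp_pos rfl))) (.var rfl)) h₁)
              (.var rfl)) h₂)))⟩

end Semantics

/-! ### Correctness and running time of the search -/

section Search

open scoped Classical

variable {n M : ℕ} {lab : Fin n → Label}

/-- A bound for the running time of `acceptsCode` and `seededCode` without the recursive calls, on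
a graph with `n` vertices and labels of size at most `M`. -/
def nodeCost (M n : ℕ) : ℕ := 1000 * ((M + 1) * (n + 1) ^ 2)

theorem scan_le_nodeCost (M n : ℕ) :
    10 * (((20 * M + 50) * (n + 1) + 50) * (n + 1)) ≤ nodeCost M n := by
  unfold nodeCost
  nlinarith [Nat.zero_le (M * n * n), Nat.zero_le (M * n), Nat.zero_le (n * n)]

theorem succ_le_nodeCost (M n : ℕ) : 1000 * (n + 1) ≤ nodeCost M n := by
  unfold nodeCost
  nlinarith [Nat.zero_le (M * n * n), Nat.zero_le (M * n), Nat.zero_le (n * n)]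

theorem size_le_of_mem_ofFn (hM : ∀ v, (encodeLabel (lab v)).size ≤ M) :
    ∀ l ∈ List.ofFn lab, (encodeLabel l).size ≤ M := by
  intro l hl
  obtain ⟨v, rfl⟩ := (List.mem_ofFn' _ _).1 hl
  exact hM v

theorem exists_relabel_eq_ofFn (s : Label) {t : Label}
    (hM : ∀ v, (encodeLabel (lab v)).size ≤ M) (ht : (encodeLabel t).size ≤ M) :
    ∃ lab' : Fin n → Label, relabel s t (List.ofFn lab) = List.ofFn lab' ∧
      ∀ v, (encodeLabel (lab' v)).size ≤ M := by
  refine ⟨_, relabel_ofFn _ _ _, fun v => ?_⟩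
  split_ifs
  exacts [ht, hM v]

theorem exists_eval_violation (G : SimpleGraph (Fin n))
    (hM : ∀ v, (encodeLabel (lab v)).size ≤ M) :
    ∃ t, 10 * t ≤ nodeCost M n ∧ Eval codes [.cons (encodeLabels (List.ofFn lab))
      (.cons (encodeRows (adjRows G)) (encodeLabels (List.ofFn lab)))] violationCode
      (encodeViolation (violation (List.ofFn lab) (List.ofFn lab) (adjRows G))) t := by
  obtain ⟨t, ht, h⟩ := evalsIn_violation (m := n) (List.ofFn lab) (List.ofFn lab) (adjRows G)
    (size_le_of_mem_ofFn hM) (by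
      intro row hrow
      obtain ⟨i, rfl⟩ := (List.mem_ofFn' _ _).1 hrow
      simp)
  have hrows : (adjRows G).length = n := List.length_ofFn
  rw [hrows] at ht
  exact ⟨t, by linarith [scan_le_nodeCost M n], h⟩

theorem exists_eval_classCount (hM : ∀ v, (encodeLabel (lab v)).size ≤ M) :
    ∃ t, 10 * t ≤ nodeCost M n ∧ Eval codes [encodeLabels (List.ofFn lab)] classCountCode
      (encodeUnary (classCount (List.ofFn lab))) t := by
  have hlen : (List.ofFn lab).length = n := List.length_ofFn
  obtain ⟨t, ht, h⟩ := evalsIn_classCount (m := n) _ (size_le_of_mem_ofFn hM) hlen.le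
  rw [hlen] at ht
  exact ⟨t, by linarith [scan_le_nodeCost M n], h⟩

theorem exists_eval_ge (ℓ : ℕ) :
    ∃ t, 10 * t ≤ nodeCost M n ∧ Eval codes [.cons (encodeUnary (classCount (List.ofFn lab)))
      (encodeNat ℓ)] geCode (encodeProp (ℓ ≤ classCount (List.ofFn lab))) t := by
  obtain ⟨t, ht, h⟩ := evalsIn_ge ℓ (List.replicate (classCount (List.ofFn lab)) .nil)
  have hcount : classCount (List.ofFn lab) ≤ n := by
    rw [classCount_eq]
    exact (List.toFinset_card_le _).trans (by simp)
  rw [List.length_replicate] at ht h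
  exact ⟨t, by have := succ_le_nodeCost M n; omega, h⟩

theorem exists_eval_relabel (s t : Label) (hM : ∀ v, (encodeLabel (lab v)).size ≤ M) :
    ∃ τ, 10 * τ ≤ nodeCost M n ∧ Eval codes [.cons (.cons (encodeLabel s) (encodeLabel t))
      (encodeLabels (List.ofFn lab))] relabelCode
      (encodeLabels (relabel s t (List.ofFn lab))) τ := by
  obtain ⟨τ, hτ, h⟩ := evalsIn_relabel s t _ (size_le_of_mem_ofFn hM)
  rw [List.length_ofFn] at hτ
  refine ⟨τ, le_trans ?_ (scan_le_nodeCost M n), h⟩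
  nlinarith [Nat.zero_le (M * n * n), Nat.zero_le (M * n), Nat.zero_le (n * n)]

/-- Merging the classes of two vertices yields again a labelling with labels of bounded size. -/
theorem exists_eval_merge (v x : Fin n) (hM : ∀ v, (encodeLabel (lab v)).size ≤ M) :
    ∃ lab' : Fin n → Label, merge (lab v) (lab x) (List.ofFn lab) = List.ofFn lab' ∧
      (∀ v, (encodeLabel (lab' v)).size ≤ M) ∧
      ∃ t, 10 * t ≤ nodeCost M n ∧ Eval codes [.cons (.cons (encodeLabel (lab v))
        (encodeLabel (lab x))) (encodeLabels (List.ofFn lab))] mergeCode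
        (encodeLabels (List.ofFn lab')) t := by
  obtain ⟨t, ht, h⟩ := evalsIn_merge (lab v) (lab x) _ (size_le_of_mem_ofFn hM)
  have hl : ∃ lab' : Fin n → Label, merge (lab v) (lab x) (List.ofFn lab) = List.ofFn lab' ∧
      ∀ v, (encodeLabel (lab' v)).size ≤ M := by
    unfold merge
    split_ifs
    · exact exists_relabel_eq_ofFn _ hM (hM x)
    · exact exists_relabel_eq_ofFn _ hM (hM v)
  obtain ⟨lab', hl, hM'⟩ := hl
  rw [hl] at h
  rw [List.length_ofFn] at ht
  refine ⟨lab', hl, hM', t, le_trans ?_ (scan_le_nodeCost M n), h⟩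
  nlinarith [Nat.zero_le (M * n * n), Nat.zero_le (M * n), Nat.zero_le (n * n)]

/-- The search tree is binary, and its depth is the number of mergings allowed. -/
theorem exists_eval_accepts (G : SimpleGraph (Fin n)) (ℓ : ℕ) (fuel : List Data)
    (hM : ∀ v, (encodeLabel (lab v)).size ≤ M) :
    ∃ t, t + nodeCost M n ≤ 2 ^ (fuel.length + 1) * nodeCost M n ∧
      Eval codes [.cons (encodeList fuel) (.cons (encodeLabels (List.ofFn lab))
        (.cons (encodeRows (adjRows G)) (encodeNat ℓ)))] acceptsCode
        (encodeProp (Accepts (adjRows G) ℓ fuel.length (List.ofFn lab))) t := by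
  induction fuel generalizing lab with
  | nil =>
    have hW := succ_le_nodeCost M n
    obtain ⟨t₁, ht₁, h₁⟩ := exists_eval_violation G hM
    obtain ⟨t₂, ht₂, h₂⟩ := exists_eval_classCount hM
    obtain ⟨t₃, ht₃, h₃⟩ := exists_eval_ge (M := M) (lab := lab) ℓ
    have hpow : 2 ^ (([] : List Data).length + 1) * nodeCost M n = 2 * nodeCost M n := by simp
    rw [hpow]
    rcases hv : violation (List.ofFn lab) (List.ofFn lab) (adjRows G) with _ | ⟨a, b, c⟩
    · rw [hv] at h₁
      have he : Accepts (adjRows G) ℓ ([] : List Data).length (List.ofFn lab) =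
          (ℓ ≤ classCount (List.ofFn lab)) := by simp [Accepts, hv]
      rw [he]
      exact ⟨_, by omega, .caseCons (.var rfl) (.caseCons (.var rfl) (.caseCons (.var rfl)
        (.caseNil (.call rfl (.cons (.var rfl) (.cons (.var rfl) (.var rfl))) h₁)
          (.call rfl (.cons (.call rfl (.var rfl) h₂) (.var rfl)) h₃))))⟩
    · rw [hv] at h₁
      rw [encodeProp_neg (by simp [Accepts, hv])]
      exact ⟨_, by omega, .caseCons (.var rfl) (.caseCons (.var rfl) (.caseCons (.var rfl)
        (.caseCons (.call rfl (.cons (.var rfl) (.cons (.var rfl) (.var rfl))) h₁)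
          (.caseNil (.var rfl) .nil))))⟩
  | cons d fuel ih =>
    have hW := succ_le_nodeCost M n
    obtain ⟨t₁, ht₁, h₁⟩ := exists_eval_violation G hM
    have hpow : 2 ^ ((d :: fuel).length + 1) * nodeCost M n =
        2 ^ (fuel.length + 1) * nodeCost M n + 2 ^ (fuel.length + 1) * nodeCost M n := by
      rw [List.length_cons]; ring
    rw [hpow]
    rcases hv : violation (List.ofFn lab) (List.ofFn lab) (adjRows G) with _ | ⟨a, b, c⟩
    · obtain ⟨t₂, ht₂, h₂⟩ := exists_eval_classCount hM
      obtain ⟨t₃, ht₃, h₃⟩ := exists_eval_ge (M := M) (lab := lab) ℓ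
      have hpow' : nodeCost M n ≤ 2 ^ (fuel.length + 1) * nodeCost M n :=
        Nat.le_mul_of_pos_left _ (by positivity)
      rw [hv] at h₁
      have he : Accepts (adjRows G) ℓ (d :: fuel).length (List.ofFn lab) =
          (ℓ ≤ classCount (List.ofFn lab)) := by simp [Accepts, hv]
      rw [he]
      exact ⟨_, by omega, .caseCons (.var rfl) (.caseCons (.var rfl) (.caseCons (.var rfl)
        (.caseNil (.call rfl (.cons (.var rfl) (.cons (.var rfl) (.var rfl))) h₁)
          (.call rfl (.cons (.call rfl (.var rfl) h₂) (.var rfl)) h₃))))⟩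
    · rw [hv] at h₁
      obtain ⟨v, x, y, -, -, -, -, -, rfl, rfl, rfl⟩ := violation_eq_some hv
      obtain ⟨labx, hx, hMx, tx, htx, hx'⟩ := exists_eval_merge v x hM
      obtain ⟨laby, hy, hMy, ty, hty, hy'⟩ := exists_eval_merge v y hM
      obtain ⟨sx, hsx, hsx'⟩ := ih hMx
      obtain ⟨sy, hsy, hsy'⟩ := ih hMy
      have he : Accepts (adjRows G) ℓ (d :: fuel).length (List.ofFn lab) =
          (Accepts (adjRows G) ℓ fuel.length (List.ofFn labx) ∨
            Accepts (adjRows G) ℓ fuel.length (List.ofFn laby)) := by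
        simp [Accepts, hv, hx, hy]
      rw [he]
      by_cases hacc : Accepts (adjRows G) ℓ fuel.length (List.ofFn labx)
      · rw [encodeProp_pos hacc] at hsx'
        rw [encodeProp_pos (Or.inl hacc)]
        exact ⟨_, by omega, .caseCons (.var rfl) (.caseCons (.var rfl) (.caseCons (.var rfl)
          (.caseCons (.call rfl (.cons (.var rfl) (.cons (.var rfl) (.var rfl))) h₁)
            (.caseCons (.var rfl) (.caseCons (.var rfl) (.caseCons
              (.call rfl (.cons (.var rfl) (.cons (.call rfl (.cons (.cons (.var rfl) (.var rfl))
                (.var rfl)) hx') (.cons (.var rfl) (.var rfl)))) hsx') (.tt _)))))))⟩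
      · rw [encodeProp_neg hacc] at hsx'
        rw [or_iff_right hacc |> propext]
        exact ⟨_, by omega, .caseCons (.var rfl) (.caseCons (.var rfl) (.caseCons (.var rfl)
          (.caseCons (.call rfl (.cons (.var rfl) (.cons (.var rfl) (.var rfl))) h₁)
            (.caseCons (.var rfl) (.caseCons (.var rfl) (.caseNil
              (.call rfl (.cons (.var rfl) (.cons (.call rfl (.cons (.cons (.var rfl) (.var rfl))
                (.var rfl)) hx') (.cons (.var rfl) (.var rfl)))) hsx')
              (.call rfl (.cons (.var rfl) (.cons (.call rfl (.cons (.cons (.var rfl) (.var rfl))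
                (.var rfl)) hy') (.cons (.var rfl) (.var rfl)))) hsy')))))))⟩

theorem exists_eval_seeded (G : SimpleGraph (Fin n)) (ℓ : ℕ) (fuel : List Data) (k : ℕ)
    (S : List Label) (hM : ∀ v, (encodeLabel (lab v)).size ≤ M)
    (hS : ∀ s ∈ S, (encodeLabel (s.2, s.2)).size ≤ M) :
    ∃ t, t + nodeCost M n ≤
        (2 ^ (fuel.length + 1) + 1) * nodeCost M n * (S.length + 2) ^ k ∧
      Eval codes [.cons (encodeUnary k) (.cons (encodeLabels S) (.cons
        (encodeLabels (List.ofFn lab))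
        (.cons (encodeList fuel) (.cons (encodeRows (adjRows G)) (encodeNat ℓ)))))] seededCode
        (encodeProp (AcceptsSeeded (adjRows G) ℓ fuel.length k S (List.ofFn lab))) t := by
  have hW := succ_le_nodeCost M n
  have hQ : 1 * nodeCost M n ≤ (2 ^ (fuel.length + 1) + 1) * nodeCost M n :=
    Nat.mul_le_mul_right _ (Nat.le_add_left 1 _)
  have hzero : ∀ (S : List Label) (lab : Fin n → Label),
      (∀ v, (encodeLabel (lab v)).size ≤ M) → ∃ t, t + nodeCost M n ≤
        (2 ^ (fuel.length + 1) + 1) * nodeCost M n * (S.length + 2) ^ 0 ∧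
      Eval codes [.cons (encodeUnary 0) (.cons (encodeLabels S) (.cons
        (encodeLabels (List.ofFn lab))
        (.cons (encodeList fuel) (.cons (encodeRows (adjRows G)) (encodeNat ℓ)))))] seededCode
        (encodeProp (AcceptsSeeded (adjRows G) ℓ fuel.length 0 S (List.ofFn lab))) t := by
    intro S lab hM
    obtain ⟨t, ht, h⟩ := exists_eval_accepts G ℓ fuel hM
    have he : AcceptsSeeded (adjRows G) ℓ fuel.length 0 S (List.ofFn lab) =
      Accepts (adjRows G) ℓ fuel.length (List.ofFn lab) := by simp [AcceptsSeeded]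
    rw [he, pow_zero, mul_one, add_mul, one_mul]
    exact ⟨_, by omega, .caseCons (.var rfl) (.caseCons (.var rfl) (.caseCons (.var rfl)
      (.caseNil (.var rfl) (.caseCons (.var rfl)
        (.call rfl (.cons (.var rfl) (.cons (.var rfl) (.var rfl))) h)))))⟩
  generalize hQ' : (2 ^ (fuel.length + 1) + 1) * nodeCost M n = Q at *
  induction S generalizing k lab with
  | nil =>
    cases k with
    | zero => exact hzero _ _ hM
    | succ k =>
      rw [encodeProp_neg (by simp [AcceptsSeeded])]
      have hp : Q * 2 ≤ Q * (([] : List Label).length + 2) ^ (k + 1) :=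
        Nat.mul_le_mul_left _ (by
          have := Nat.one_le_two_pow (n := k)
          rw [List.length_nil, zero_add, pow_succ]
          omega)
      exact ⟨_, by omega, .caseCons (.var rfl) (.caseCons (.var rfl) (.caseCons (.var rfl)
        (.caseCons (.var rfl) (.caseNil (.var rfl) .nil))))⟩
  | cons s S ih =>
    cases k with
    | zero => exact hzero _ _ hM
    | succ k =>
      have hs := hS s List.mem_cons_self
      have hS' : ∀ s ∈ S, (encodeLabel (s.2, s.2)).size ≤ M := fun s' h =>
        hS s' (List.mem_cons_of_mem _ h)
      obtain ⟨lab', hl, hM'⟩ := exists_relabel_eq_ofFn s hM hs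
      obtain ⟨tr, htr, hr⟩ := exists_eval_relabel s (s.2, s.2) hM
      rw [hl] at hr
      obtain ⟨t₁, ht₁, h₁⟩ := ih k hM' hS'
      obtain ⟨t₂, ht₂, h₂⟩ := ih (k + 1) hM hS'
      have hp : Q * (S.length + 2) ^ k + Q * (S.length + 2) ^ (k + 1) ≤
          Q * ((s :: S).length + 2) ^ (k + 1) := by
        rw [← mul_add]
        refine Nat.mul_le_mul_left _ ?_
        rw [List.length_cons, pow_succ, pow_succ, ← mul_one_add]
        exact Nat.mul_le_mul (Nat.pow_le_pow_left (by omega) k) (by omega)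
      have he : AcceptsSeeded (adjRows G) ℓ fuel.length (k + 1) (s :: S) (List.ofFn lab) =
          (AcceptsSeeded (adjRows G) ℓ fuel.length k S (List.ofFn lab') ∨
            AcceptsSeeded (adjRows G) ℓ fuel.length (k + 1) S (List.ofFn lab)) := by
        rw [AcceptsSeeded, hl]
      rw [he]
      by_cases hacc : AcceptsSeeded (adjRows G) ℓ fuel.length k S (List.ofFn lab')
      · rw [encodeProp_pos hacc] at h₁
        rw [encodeProp_pos (Or.inl hacc)]
        exact ⟨_, by omega, .caseCons (.var rfl) (.caseCons (.var rfl) (.caseCons (.var rfl)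
          (.caseCons (.var rfl) (.caseCons (.var rfl) (.caseCons (.var rfl) (.caseCons
            (.call rfl (.cons (.var rfl) (.cons (.var rfl) (.cons (.call rfl (.cons (.cons
              (.var rfl) (.cons (.var rfl) (.var rfl))) (.var rfl)) hr) (.var rfl)))) h₁)
            (.tt _)))))))⟩
      · rw [encodeProp_neg hacc] at h₁
        rw [or_iff_right hacc |> propext]
        exact ⟨_, by omega, .caseCons (.var rfl) (.caseCons (.var rfl) (.caseCons (.var rfl)
          (.caseCons (.var rfl) (.caseCons (.var rfl) (.caseCons (.var rfl) (.caseNil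
            (.call rfl (.cons (.var rfl) (.cons (.var rfl) (.cons (.call rfl (.cons (.cons
              (.var rfl) (.cons (.var rfl) (.var rfl))) (.var rfl)) hr) (.var rfl)))) h₁)
            (.call rfl (.cons (.var rfl) (.cons (.var rfl) (.cons (.var rfl)
              (.var rfl)))) h₂)))))))⟩

end Search

/-! ### Initial labellings and seeds -/

section Initial

open scoped Classical

/-- The nonempty final segments of a list, as data. They serve as identifiers of the vertices. -/
def suffixes : List Data → List Data
  | [] => []
  | d :: ds => encodeList (d :: ds) :: suffixes ds

theorem length_suffixes (ds : List Data) : (suffixes ds).length = ds.length := by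
  induction ds with
  | nil => rfl
  | cons d ds ih => simp [suffixes, ih]

theorem size_le_of_mem_suffixes {ds : List Data} {e : Data} (he : e ∈ suffixes ds) :
    e.size ≤ (encodeList ds).size ∧ e ≠ .nil := by
  induction ds with
  | nil => simp [suffixes] at he
  | cons d ds ih =>
    rcases List.mem_cons.1 he with rfl | he
    · exact ⟨le_rfl, by simp [encodeList]⟩
    · refine ⟨(ih he).1.trans ?_, (ih he).2⟩
      simp only [encodeList, Data.size]
      omega

theorem nodup_suffixes (ds : List Data) : (suffixes ds).Nodup := by
  induction ds with
  | nil => simp [suffixes]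
  | cons d ds ih =>
    refine List.nodup_cons.2 ⟨fun h => ?_, ih⟩
    have := (size_le_of_mem_suffixes h).1
    simp only [encodeList, Data.size] at this
    omega

theorem evalsIn_freeLabels (ds : List Data) :
    EvalsIn [encodeList ds] freeLabelsCode
      (encodeLabels ((suffixes ds).map fun i => (.nil, i))) (20 * (ds.length + 1)) := by
  induction ds with
  | nil => exact ⟨_, by simp, .caseNil (.var rfl) .nil⟩
  | cons d ds ih =>
    obtain ⟨t, ht, h⟩ := ih
    exact ⟨_, by rw [List.length_cons]; omega, .caseCons (.var rfl) (.cons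
      (.cons .nil (.var rfl)) (.call rfl (.var rfl) h))⟩

theorem evalsIn_fullLabels (ds : List Data) :
    EvalsIn [encodeList ds] fullLabelsCode
      (encodeLabels ((suffixes ds).map fun i => (i, i))) (20 * (ds.length + 1)) := by
  induction ds with
  | nil => exact ⟨_, by simp, .caseNil (.var rfl) .nil⟩
  | cons d ds ih =>
    obtain ⟨t, ht, h⟩ := ih
    exact ⟨_, by rw [List.length_cons]; omega, .caseCons (.var rfl) (.cons
      (.cons (.var rfl) (.var rfl)) (.call rfl (.var rfl) h))⟩

theorem exists_suffixes_eq_ofFn {n : ℕ} {ds : List Data} (hn : ds.length = n) :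
    ∃ ident : Fin n → Data, suffixes ds = List.ofFn ident ∧ Function.Injective ident ∧
      ∀ v, ident v ≠ .nil ∧ (ident v).size ≤ (encodeList ds).size := by
  have hlen : (suffixes ds).length = n := (length_suffixes ds).trans hn
  subst hlen
  refine ⟨(suffixes ds).get, (List.ofFn_get _).symm, (nodup_suffixes ds).injective_get,
    fun v => ?_⟩
  have := size_le_of_mem_suffixes (List.get_mem (suffixes ds) v)
  exact ⟨this.2, this.1⟩

variable {n : ℕ} {G : SimpleGraph (Fin n)} {ident : Fin n → Data} {ℓ : ℕ}

/-- Starting from one-element classes, with no free vertices, the search is correct: the colour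
`none`, which is not used, plays the role of the part whose vertices stay free. -/
theorem accepts_full_iff (hinj : Function.Injective ident) (hnil : ∀ v, ident v ≠ .nil)
    (hℓ : 1 ≤ ℓ) :
    Accepts (adjRows G) ℓ n (List.ofFn fun v => (ident v, ident v)) ↔
      HasMatchingMulticut G ℓ := by
  refine ⟨hasMatchingMulticut_of_accepts, fun h => ?_⟩
  obtain ⟨p, hp, hcut⟩ := h.exists_coloring hℓ
  refine accepts_of_compatible (p := some ∘ p) (r := none) (hcut.comp _) ?_ ⟨?_, ?_, ?_, ?_⟩ ?_
  · rw [Set.range_comp, hp.range_eq, Set.ncard_image_of_injective _ (Option.some_injective _)]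
    simp
  · intro x y h
    rw [hinj (congrArg Prod.fst h)]
  · intro x y h _
    rw [hinj h]
  · simp
  · intro x _
    exact ⟨x, hnil x, rfl⟩
  · exact (card_pending_le (s := Finset.univ) fun z _ => Finset.mem_univ z).trans (by simp)

/-- Starting from one seed in each part but a largest one, whose vertices stay free, the search is
correct if it allows `f = ⌊(ℓ - 1) n / ℓ⌋` mergings or more: a largest part has at least `n / ℓ`
vertices, so that no more than `f` vertices lie outside it. -/
theorem acceptsSeeded_iff (hinj : Function.Injective ident) (hnil : ∀ v, ident v ≠ .nil)
    (hℓ : 1 ≤ ℓ) {f : ℕ} (hf : (ℓ - 1) * n < ℓ * (f + 1)) :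
    AcceptsSeeded (adjRows G) ℓ f (ℓ - 1) (List.ofFn fun v => (.nil, ident v))
      (List.ofFn fun v => (.nil, ident v)) ↔ HasMatchingMulticut G ℓ := by
  refine ⟨hasMatchingMulticut_of_acceptsSeeded, fun h => ?_⟩
  obtain ⟨p, hp, hcut⟩ := h.exists_coloring hℓ
  -- a largest part `r` has at least `n / ℓ` vertices
  obtain ⟨r, hr⟩ : ∃ r, n ≤ ℓ * (Finset.univ.filter fun z => p z = r).card := by
    have : Nonempty (Fin ℓ) := ⟨⟨0, hℓ⟩⟩
    obtain ⟨r, -, hr⟩ := Finset.exists_max_image Finset.univ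
      (fun i => (Finset.univ.filter fun z => p z = i).card) Finset.univ_nonempty
    refine ⟨r, ?_⟩
    have h1 := Finset.card_eq_sum_card_fiberwise (f := p) (s := Finset.univ) (t := Finset.univ)
      (fun _ _ => Finset.mem_coe.2 (Finset.mem_univ _))
    have h2 := Finset.sum_le_card_nsmul Finset.univ
      (fun i => (Finset.univ.filter fun z => p z = i).card) _ hr
    rw [← h1] at h2
    simpa using h2
  choose g hg using hp
  have hginj : Function.Injective g := fun i j hij => by rw [← hg i, ← hg j, hij]
  set seeds : Finset (Fin n) := (Finset.univ.erase r).image g with hseeds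
  have hmem : ∀ v, v ∈ seeds → p v ≠ r := by
    intro v hv
    obtain ⟨i, hi, rfl⟩ := Finset.mem_image.1 hv
    rw [hg]
    exact Finset.ne_of_mem_erase hi
  set T : List Label := ((List.finRange n).filter fun v => decide (v ∈ seeds)).map
    fun v => (.nil, ident v) with hT
  have hTlen : T.length = ℓ - 1 := by
    have hcard : seeds.card = ℓ - 1 := by
      rw [hseeds, Finset.card_image_of_injective _ hginj, Finset.card_erase_of_mem
        (Finset.mem_univ _), Finset.card_univ, Fintype.card_fin]
    rw [hT, List.length_map, ← hcard, ← List.toFinset_card_of_nodup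
      ((List.nodup_finRange n).filter _)]
    congr 1
    ext v
    simp
  have hTmem : ∀ v, ((.nil, ident v) : Label) ∈ T ↔ v ∈ seeds := by
    intro v
    rw [hT, List.mem_map]
    constructor
    · rintro ⟨w, hw, hwv⟩
      obtain rfl := hinj (congrArg Prod.snd hwv)
      simpa using hw
    · intro hv
      exact ⟨v, by simpa using hv, rfl⟩
  rw [← hTlen]
  refine acceptsSeeded_of_sublist ?_ ?_ ?_
  · rw [hT, List.ofFn_eq_map]
    exact List.filter_sublist.map _
  · intro l hl
    rw [hT, List.mem_map] at hl
    obtain ⟨v, -, rfl⟩ := hl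
    exact ⟨rfl, hnil v⟩
  · obtain ⟨lab, hlab⟩ : ∃ lab : Fin n → Label, ∀ v, lab v =
      if v ∈ seeds then (ident v, ident v) else (.nil, ident v) := ⟨_, fun _ => rfl⟩
    have hmap : (List.ofFn fun v => ((.nil, ident v) : Label)).map
        (fun l => if l ∈ T then (l.2, l.2) else l) = List.ofFn lab := by
      rw [List.map_ofFn]
      congr 1
      funext v
      simp only [Function.comp_apply, hTmem, hlab]
    rw [hmap]
    have hsnd : ∀ v, (lab v).2 = ident v := fun v => by rw [hlab]; split_ifs <;> rfl
    have hfst : ∀ v, (lab v).1 ≠ .nil → v ∈ seeds := fun v hv => by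
      by_contra hvs
      simp [hlab, hvs] at hv
    refine accepts_of_compatible (p := p) (r := r) hcut ?_ ⟨?_, ?_, ?_, ?_⟩ ?_
    · rw [Function.Surjective.range_eq fun i => ⟨g i, hg i⟩]
      simp
    · intro x y hxy
      have := congrArg Prod.snd hxy
      rw [hsnd, hsnd] at this
      rw [hinj this]
    · intro x y hxy hx
      have hxs := hfst x hx
      have hys := hfst y (hxy ▸ hx)
      rw [hlab, hlab, if_pos hxs, if_pos hys] at hxy
      rw [hinj hxy]
    · intro x hx
      exact hmem x (hfst x hx)
    · intro x hx
      have hs : g (p x) ∈ seeds :=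
        Finset.mem_image_of_mem _ (Finset.mem_erase.2 ⟨hx, Finset.mem_univ _⟩)
      refine ⟨g (p x), ?_, hg _⟩
      rw [hlab, if_pos hs]
      exact hnil _
    · refine (card_pending_le (s := Finset.univ.filter fun z => ¬ p z = r) fun z hz =>
        Finset.mem_filter.2 ⟨Finset.mem_univ _, ?_⟩).trans ?_
      · rcases hz with hz | hz
        exacts [hmem z (hfst z hz), hz]
      have hsum := Finset.card_filter_add_card_filter_not (s := (Finset.univ : Finset (Fin n)))
        (fun z => p z = r)
      rw [Finset.card_univ, Fintype.card_fin] at hsum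
      generalize (Finset.univ.filter fun z => p z = r).card = a at *
      generalize (Finset.univ.filter fun z => ¬ p z = r).card = b at *
      obtain ⟨m, rfl⟩ := Nat.exists_eq_add_of_le' hℓ
      simp only [Nat.add_sub_cancel] at hf
      have : (m + 1) * b < (m + 1) * (f + 1) := by nlinarith
      exact Nat.lt_succ_iff.1 (Nat.lt_of_mul_lt_mul_left this)

theorem encodeGraph_eq (G : SimpleGraph (Fin n)) : encodeGraph G = encodeRows (adjRows G) := by
  simp only [encodeGraph, encodeRows, adjRows, List.map_ofFn]
  congr 2
  funext i
  rw [Function.comp_apply, encodeRow, List.map_ofFn]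
  rfl

theorem size_encodeList_le {B : ℕ} (L : List Data) (h : ∀ d ∈ L, d.size ≤ B) :
    (encodeList L).size ≤ L.length * (B + 1) + 1 := by
  induction L with
  | nil => simp [encodeList, Data.size]
  | cons d L ih =>
    have h1 := h d List.mem_cons_self
    have h2 := ih fun e he => h e (List.mem_cons_of_mem _ he)
    simp only [encodeList, Data.size, List.length_cons, Nat.add_mul]
    omega

theorem size_encodeProp_le (p : Prop) : (encodeProp p).size ≤ 3 := by
  unfold encodeProp
  split_ifs <;> simp [Data.size]

theorem size_encodeRows_le (G : SimpleGraph (Fin n)) :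
    (encodeRows (adjRows G)).size ≤ n * (n * 4 + 2) + 1 := by
  have h := size_encodeList_le (B := n * 4 + 1) ((adjRows G).map encodeRow) (by
    intro d hd
    obtain ⟨row, hrow, rfl⟩ := List.mem_map.1 hd
    obtain ⟨i, rfl⟩ := (List.mem_ofFn' _ _).1 hrow
    have h := size_encodeList_le (B := 3) ((List.ofFn fun j => G.Adj i j).map encodeProp) (by
      intro d hd
      obtain ⟨q, -, rfl⟩ := List.mem_map.1 hd
      exact size_encodeProp_le q)
    rw [List.length_map, List.length_ofFn] at h
    exact h)
  rw [List.length_map, adjRows, List.length_ofFn] at h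
  exact h

theorem encodeNat_of_ne_zero {m : ℕ} (h : m ≠ 0) :
    encodeNat m = .cons (encodeProp (m.bodd = true)) (encodeNat m.div2) := by
  conv_lhs => rw [← Nat.bit_bodd_div2 m]
  refine encodeNat_bit _ _ fun h0 => ?_
  have := Nat.bodd_add_div2 m
  rw [h0] at this
  cases hb : m.bodd
  · simp [hb] at this
    exact (h this.symm).elim
  · rfl

theorem encodeNat_one : encodeNat 1 = .cons (.cons .nil .nil) .nil := by
  rw [encodeNat_of_ne_zero one_ne_zero, ← encodeNat_zero]
  congr 1
  exact encodeProp_pos rfl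

end Initial

/-! ### The running time of the program -/

section Main

/-- Up to three classes are seeded, so that the polynomial factors stay bounded. -/
theorem seeded_bound {W n f k : ℕ} (hW : W ≤ 8000 * (n + 1) ^ 4) (hk : k ≤ 2) :
    (2 ^ (f + 1) + 1) * W * (n + 2) ^ k ≤ 96000 * (2 ^ f * (n + 1) ^ 6) := by
  have h1 : 2 ^ (f + 1) + 1 ≤ 3 * 2 ^ f := by
    have := Nat.one_le_two_pow (n := f)
    rw [pow_succ]
    omega
  have h2 : (n + 2) ^ k ≤ 4 * (n + 1) ^ 2 :=
    calc (n + 2) ^ k ≤ (n + 2) ^ 2 := Nat.pow_le_pow_right (by omega) hk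
      _ ≤ (2 * (n + 1)) ^ 2 := Nat.pow_le_pow_left (by omega) 2
      _ = 4 * (n + 1) ^ 2 := by ring
  calc (2 ^ (f + 1) + 1) * W * (n + 2) ^ k
      ≤ (3 * 2 ^ f) * (8000 * (n + 1) ^ 4) * (4 * (n + 1) ^ 2) :=
        Nat.mul_le_mul (Nat.mul_le_mul h1 hW) h2
    _ = 96000 * (2 ^ f * (n + 1) ^ 6) := by ring

/-- The program is correct, and its running time is polynomial up to a factor `2 ^ f`, where `f` is
the depth of the search tree. -/
theorem exists_runs {n : ℕ} (G : SimpleGraph (Fin n)) {ℓ : ℕ} (hℓ : 1 ≤ ℓ) :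
    ∃ t f, multicutProgram.Runs (encodeInstance G ℓ) (encodeProp (HasMatchingMulticut G ℓ)) t ∧
      t ≤ 100000 * (2 ^ f * (n + 1) ^ 6) ∧ (2 ^ f) ^ 2 ≤ min ℓ 4 ^ n := by
  have hrows : ((adjRows G).map encodeRow).length = n := by simp [adjRows]
  obtain ⟨ident, hident, hinj, hid⟩ := exists_suffixes_eq_ofFn hrows
  have hnil := fun v => (hid v).1
  obtain ⟨M, hMdef⟩ : ∃ M, M = 2 * (n * (n * 4 + 2) + 1) + 2 := ⟨_, rfl⟩
  have hsize : ∀ v, (ident v).size ≤ n * (n * 4 + 2) + 1 := fun v =>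
    (hid v).2.trans (size_encodeRows_le G)
  have hM0 : ∀ v, (encodeLabel (.nil, ident v)).size ≤ M := fun v => by
    have := hsize v
    simp only [encodeLabel, Data.size]
    omega
  have hM1 : ∀ v, (encodeLabel (ident v, ident v)).size ≤ M := fun v => by
    have := hsize v
    simp only [encodeLabel, Data.size]
    omega
  obtain ⟨t₀, ht₀, h₀⟩ := evalsIn_freeLabels ((adjRows G).map encodeRow)
  rw [hident, List.map_ofFn] at h₀
  rw [hrows] at ht₀
  have hS : ∀ s ∈ List.ofFn (fun v => ((.nil, ident v) : Label)),
      (encodeLabel (s.2, s.2)).size ≤ M := by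
    intro s hs
    obtain ⟨v, rfl⟩ := (List.mem_ofFn' _ _).1 hs
    exact hM1 v
  have hW : nodeCost M n ≤ 8000 * (n + 1) ^ 4 := by
    have : M + 1 ≤ 8 * (n + 1) ^ 2 := by rw [hMdef]; nlinarith
    unfold nodeCost
    nlinarith [Nat.mul_le_mul_right ((n + 1) ^ 2) this]
  have hlin : ∀ f, n + 1 ≤ 2 ^ f * (n + 1) ^ 6 := fun f =>
    calc n + 1 = 1 * (n + 1) ^ 1 := by ring
      _ ≤ 2 ^ f * (n + 1) ^ 6 :=
        Nat.mul_le_mul Nat.one_le_two_pow (Nat.pow_le_pow_right (by omega) (by omega))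
  have hseeded : ∀ fuel : List Data, (ℓ - 1) * n < ℓ * (fuel.length + 1) → ℓ ≤ 3 → ∃ t,
      t ≤ 96000 * (2 ^ fuel.length * (n + 1) ^ 6) ∧ Eval codes
        [.cons (encodeUnary (ℓ - 1)) (.cons (encodeLabels (List.ofFn fun v => (.nil, ident v)))
          (.cons (encodeLabels (List.ofFn fun v => (.nil, ident v))) (.cons (encodeList fuel)
            (.cons (encodeRows (adjRows G)) (encodeNat ℓ)))))] seededCode
        (encodeProp (HasMatchingMulticut G ℓ)) t := by
    intro fuel hf h3
    obtain ⟨t, ht, h⟩ := exists_eval_seeded G ℓ fuel (ℓ - 1) _ hM0 hS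
    rw [propext (acceptsSeeded_iff hinj hnil hℓ hf)] at h
    rw [List.length_ofFn] at ht
    have := seeded_bound (f := fuel.length) (k := ℓ - 1) hW (by omega)
    exact ⟨t, by omega, h⟩
  rw [encodeInstance, encodeGraph_eq]
  obtain rfl | rfl | rfl | h4 : ℓ = 1 ∨ ℓ = 2 ∨ ℓ = 3 ∨ 4 ≤ ℓ := by omega
  · obtain ⟨t, ht, h⟩ := hseeded [] (by simp) (by omega)
    have hX := hlin 0
    refine ⟨_, 0, .caseCons (.var rfl) (.letIn (.call rfl (.var rfl) h₀) (.caseCons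
      (.var (congrArg some encodeNat_one)) (.caseNil (.var rfl) (.call rfl (.cons .nil (.cons
        (.var rfl) (.cons (.var rfl) (.cons .nil (.cons (.var rfl) (.var rfl)))))) h)))), ?_,
      by simp⟩
    rw [List.length_nil] at ht
    omega
  · obtain ⟨t, ht, h⟩ := hseeded (List.replicate (n / 2) .nil)
      (by rw [List.length_replicate]; omega) (by omega)
    obtain ⟨t₁, ht₁, h₁⟩ := evalsIn_half ((adjRows G).map encodeRow)
    rw [hrows] at h₁ ht₁
    rw [List.length_replicate] at ht
    have hX := hlin (n / 2)
    have hb : encodeNat 2 = .cons .nil (.cons (.cons .nil .nil) .nil) := by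
      rw [encodeNat_of_ne_zero two_ne_zero, ← encodeNat_one]
      congr 1
      exact encodeProp_neg (by simp)
    refine ⟨_, n / 2, .caseCons (.var rfl) (.letIn (.call rfl (.var rfl) h₀) (.caseCons
      (.var (congrArg some hb)) (.caseCons (.var rfl) (.caseNil (.var rfl) (.caseNil (.var rfl)
        (.call rfl (.cons (.tt _) (.cons (.var rfl) (.cons (.var rfl) (.cons
          (.call rfl (.var rfl) h₁) (.cons (.var rfl) (.var rfl)))))) h)))))), ?_, ?_⟩
    · omega
    · rw [← pow_mul]
      exact Nat.pow_le_pow_right (by omega) (by omega)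
  · obtain ⟨t, ht, h⟩ := hseeded (List.replicate (2 * n / 3) .nil)
      (by rw [List.length_replicate]; omega) (by omega)
    obtain ⟨t₁, ht₁, h₁⟩ := evalsIn_twoThirds ((adjRows G).map encodeRow)
    rw [hrows] at h₁ ht₁
    rw [List.length_replicate] at ht
    have hX := hlin (2 * n / 3)
    have hb : encodeNat 3 = .cons (.cons .nil .nil) (.cons (.cons .nil .nil) .nil) := by
      rw [encodeNat_of_ne_zero three_ne_zero, ← encodeNat_one]
      congr 1
      exact encodeProp_pos (by simp)
    refine ⟨_, 2 * n / 3, .caseCons (.var rfl) (.letIn (.call rfl (.var rfl) h₀) (.caseCons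
      (.var (congrArg some hb)) (.caseCons (.var rfl) (.caseNil (.var rfl) (.caseCons (.var rfl)
        (.call rfl (.cons (.cons .nil (.tt _)) (.cons (.var rfl) (.cons (.var rfl) (.cons
          (.call rfl (.var rfl) h₁) (.cons (.var rfl) (.var rfl)))))) h)))))), ?_, ?_⟩
    · omega
    · -- `2 ^ 4 ≤ 3 ^ 3`
      have h16 : (2 ^ (2 * n / 3)) ^ 2 ≤ 2 ^ (n + n / 3) := by
        rw [← pow_mul]
        exact Nat.pow_le_pow_right (by omega) (by omega)
      refine h16.trans ?_
      have hn : n = 3 * (n / 3) + n % 3 := by omega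
      calc 2 ^ (n + n / 3) = 16 ^ (n / 3) * 2 ^ (n % 3) := by
            rw [show (16 : ℕ) = 2 ^ 4 by norm_num, ← pow_mul, ← pow_add]
            congr 1
            omega
        _ ≤ 27 ^ (n / 3) * 3 ^ (n % 3) :=
            Nat.mul_le_mul (Nat.pow_le_pow_left (by omega) _) (Nat.pow_le_pow_left (by omega) _)
        _ = min 3 4 ^ n := by
            rw [show (27 : ℕ) = 3 ^ 3 by norm_num, ← pow_mul, ← pow_add, ← hn]
            rfl
  · obtain ⟨t₁, ht₁, h₁⟩ := evalsIn_fullLabels ((adjRows G).map encodeRow)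
    rw [hident, List.map_ofFn] at h₁
    rw [hrows] at ht₁
    obtain ⟨t, ht, h⟩ := exists_eval_accepts G ℓ ((adjRows G).map encodeRow) hM1
    rw [hrows, propext (accepts_full_iff hinj hnil hℓ)] at h
    rw [hrows] at ht
    have hX := hlin n
    have hbound := seeded_bound (f := n) (k := 0) hW (by omega)
    rw [pow_zero, mul_one, Nat.add_mul] at hbound
    have hdiv : ∀ m, Nat.div2 m = m / 2 := Nat.div2_val
    have hb : encodeNat ℓ = _ := encodeNat_of_ne_zero (by omega)
    have hb' : encodeNat ℓ.div2 = _ := encodeNat_of_ne_zero (by rw [hdiv]; omega)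
    have hb'' : encodeNat ℓ.div2.div2 = _ :=
      encodeNat_of_ne_zero (by rw [hdiv, hdiv]; omega)
    refine ⟨_, n, .caseCons (.var rfl) (.letIn (.call rfl (.var rfl) h₀) (.caseCons
      (.var (congrArg some hb)) (.caseCons (.var (congrArg some hb')) (.caseCons
        (.var (congrArg some hb'')) (.call rfl (.cons (.var rfl) (.cons
          (.call rfl (.var rfl) h₁) (.cons (.var rfl) (.var rfl)))) h))))), ?_, ?_⟩
    · omega
    · rw [min_eq_right h4, ← pow_mul, mul_comm, pow_mul]
      norm_num

end Main

end MatchingMulticut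

open MatchingMulticut in
theorem mainTheorem3 :
    (∀ (V : Type*) [Finite V] (G : SimpleGraph V) (ℓ : ℕ) (A : Fin ℓ → Set V),
      1 ≤ ℓ →
      (∀ v, 2 ≤ deg G v) →
      (∀ i, (A i).Nonempty) →
      (∀ i j, i ≠ j → Disjoint (A i) (A j)) →
      ¬ StoppingApplicable G A →
      ¬ ReductionApplicable G A →
      ¬ BranchingApplicable G A →
      IsMatchingMulticut G (phiStar G A)) ∧
    (∃ α : ℕ → ℝ, (∀ ℓ, 1 ≤ ℓ → 0 < α ℓ ∧ α ℓ ≤ √(ℓ : ℝ)) ∧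
      ∃ (P : Program) (c : ℕ), ∀ (n : ℕ) (G : SimpleGraph (Fin n)) (ℓ : ℕ), 1 ≤ ℓ →
        ∃ t : ℕ, P.Runs (encodeInstance G ℓ) (encodeProp (HasMatchingMulticut G ℓ)) t ∧
          (t : ℝ) ≤ c * α ℓ ^ n * ((n : ℝ) + 1) ^ c) := by
  -- the constant is made opaque, since it occurs as an exponent
  obtain ⟨c, hc⟩ : ∃ c : ℕ, c = 100000 := ⟨_, rfl⟩
  refine ⟨fun V _ G ℓ A hℓ hdeg hne hdis hS hR hB =>
    isMatchingMulticut_phiStar hℓ hdeg hne hdis hS hR hB, fun ℓ => √((min ℓ 4 : ℕ) : ℝ), ?_,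
    multicutProgram, c, ?_⟩
  · intro ℓ hℓ
    refine ⟨Real.sqrt_pos.2 (Nat.cast_pos.2 (lt_min hℓ (by norm_num))), ?_⟩
    exact Real.sqrt_le_sqrt (Nat.cast_le.2 (min_le_left _ _))
  · intro n G ℓ hℓ
    obtain ⟨t, f, hrun, ht, hf⟩ := exists_runs G hℓ
    rw [← hc] at ht
    refine ⟨t, hrun, ?_⟩
    have hf' : (2 : ℝ) ^ f ≤ √((min ℓ 4 : ℕ) : ℝ) ^ n := by
      refine le_of_sq_le_sq ?_ (by positivity)
      rw [← pow_mul √_, mul_comm n 2, pow_mul √_, Real.sq_sqrt (Nat.cast_nonneg _)]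
      exact_mod_cast hf
    have ht' : (t : ℝ) ≤ c * (2 ^ f * ((n : ℝ) + 1) ^ 6) := by exact_mod_cast ht
    have hpow : ((n : ℝ) + 1) ^ 6 ≤ ((n : ℝ) + 1) ^ c :=
      pow_le_pow_right₀ (by linarith [(Nat.cast_nonneg n : (0 : ℝ) ≤ n)]) (by omega)
    calc (t : ℝ) ≤ c * (2 ^ f * ((n : ℝ) + 1) ^ 6) := ht'
      _ ≤ c * (√((min ℓ 4 : ℕ) : ℝ) ^ n * ((n : ℝ) + 1) ^ c) := by gcongr
      _ = c * √((min ℓ 4 : ℕ) : ℝ) ^ n * ((n : ℝ) + 1) ^ c := (mul_assoc _ _ _).symm
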